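/- Let $n\ge 2$. Let $V$ be the free-field vertex superalgebra over $\mathbb C$ generated by bosonic fields $X_i,Y_i$ and fermionic fields $\psi_i,\chi_i$ ($1\le i\le n$) and fermionic ghosts $b_a,c^a$ ($1\le a\le n-1$), whose only nontrivial operator product expansions between generators are $$X_i(z)Y_j(0)\sim\frac{\delta_{ij}}{z},\qquad \psi_i(z)\chi_j(0)\sim\frac{\delta_{ij}}{z},\qquad b_a(z)c^{b}(0)\sim\frac{\delta_a^b}{z}$$ (and those obtained by exchanging the two fields). Put $(AB)_p(w)=\oint\frac{dz}{2\pi i}(z-w)^{p-1}A(z)B(w)$; products written by juxtaposition are normally ordered products $(AB)_0$, nested to the right: $ABC=(A(BC)_0)_0$. Let $$J_{BRST}=\sum_{a=1}^{n-1}c^a\left(X_aY_a-X_{a+1}Y_{a+1}+\psi_a\chi_a-\psi_{a+1}\chi_{a+1}\right),\qquad Q=\oint\frac{dz}{2\pi i}J_{BRST}(z),$$ and write $A\equiv B$ if $A-B=Q(w)$ for some $w\in V$. Put $\mathcal A_i=-X_iY_i$ and, for every operator $\mathcal O\in V$, $$\hat{\mathcal A}_i\mathcal O=(\mathcal A_i\mathcal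 O)_0,\qquad \mathcal D_i\mathcal O=(\mathcal A_i\mathcal O)_0+(X_i(Y_i\mathcal O)_0)_0,\qquad D_i=\mathcal D_i+\hat{\mathcal A}_i .$$ Define $$U=-\frac1n\sum_{i=1}^nX_iY_i,\quad U_F=-\frac1n\sum_{i=1}^n\psi_i\chi_i,\quad M_i^+=X_i\psi_i,\quad M_i^-=Y_i\chi_i,$$ and, for $I\subseteq\{1,\dots,n\}$, $\hat{\mathcal X}_I=A_1\cdots A_n$ with $A_i=\chi_i$ for $i\in I$ and $A_i=X_i$ for $i\notin I$, and $\hat{\mathcal Y}_I=B_1\cdots B_n$ with $B_i=\psi_i$ for $i\in I$ and $B_i=Y_i$ for $i\notin I$. For $J\subseteq\{1,\dots,n\}\setminus I$ put $\hat{\mathcal X}_{I,J}=\prod_{k\in J}D_k\hat{\mathcal X}_I$ and $\hat{\mathcal Y}_{I,J}=\prod_{k\in J}D_k\hat{\mathcal Y}_I$ (where the $D_k$ are applied in a fixed order). Finally let $\mathcal X_I=\prod_{i\in I}D_i(X_1\cdots X_n)$ and $\mathcal Y_I=\prod_{i\in I}D_i(Y_1\cdots Y_n)$; these are the operators of the bosonic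 VOA, made of the symplectic bosons $X_i,Y_i$ only. (1) For all disjoint $I,J\subseteq\{1,\dots,n\}$ and every $j\in J$, with $f_j$ the number of elements $k\in I$ with $k<j$ (that is, the number of fermions $\chi_k$, respectively $\psi_k$, with $k<j$ occurring in $\hat{\mathcal X}_{I,J\setminus\{j\}}$, respectively $\hat{\mathcal Y}_{I,J\setminus\{j\}}$), $$\hat{\mathcal X}_{I,J}=D_j\hat{\mathcal X}_{I,J\setminus\{j\}}\equiv(U+U_F)\hat{\mathcal X}_{I,J\setminus\{j\}}+(-1)^{f_j}M_j^+\hat{\mathcal X}_{I\cup\{j\},J\setminus\{j\}},$$ $$\hat{\mathcal Y}_{I,J}=D_j\hat{\mathcal Y}_{I,J\setminus\{j\}}\equiv(U+U_F)\hat{\mathcal Y}_{I,J\setminus\{j\}}-(-1)^{f_j}M_j^-\hat{\mathcal Y}_{I\cup\{j\},J\setminus\{j\}}.$$ (2) For every $I\subseteq\{1,\dots,n\}$, each of $\mathcal X_I$ and $\mathcal Y_I$ is $\equiv$ to a linear combination of the identity and iterated normally ordered products of the operators $U$, $U_F$, $M_i^{\pm}$ ($1\le i\le n$), $\hat{\mathcal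 X}_K$, $\hat{\mathcal Y}_K$ ($K\subseteq\{1,\dots,n\}$) and derivatives of such expressions. -/

import Mathlib

/-!
The free-field vertex superalgebra generated by symplectic bosons `X i, Y i`, complex fermions
`psi i, chi i` (`i = 1, …, n`) and ghosts `b a, c a` (`a = 1, …, n - 1`), with
`X i (z) Y j (0) ~ δ / z`, `psi i (z) chi j (0) ~ δ / z`, `b a (z) c a' (0) ~ δ / z`,
realised on its Fock space; its BRST charge; and the operators built from the covariant
derivatives.  Operators (fields) are identified with states as usual.
-/

noncomputable section

namespace BoundaryVOA

/-! ### Generating fields and modes -/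

/-- The bosonic generating fields. -/
inductive EvenGen (n : ℕ) : Type
  | X (i : Fin n)
  | Y (i : Fin n)

/-- The fermionic generating fields: the fermi multiplets and the ghosts. -/
inductive OddGen (n : ℕ) : Type
  | psi (i : Fin n)
  | chi (i : Fin n)
  | b (a : Fin (n - 1))
  | c (a : Fin (n - 1))

/-- A code for bosonic generators, used only to fix a linear order. -/
def EvenGen.code {n : ℕ} : EvenGen n → ℕ ×ₗ ℕ
  | .X i => toLex (0, i.val)
  | .Y i => toLex (1, i.val)

/-- A code for fermionic generators, used only to fix a linear order. -/
def OddGen.code {n : ℕ} : OddGen n → ℕ ×ₗ ℕ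
  | .psi i => toLex (0, i.val)
  | .chi i => toLex (1, i.val)
  | .b a => toLex (2, a.val)
  | .c a => toLex (3, a.val)

theorem EvenGen.code_injective (n : ℕ) : Function.Injective (EvenGen.code (n := n)) := by
  intro s t h
  cases s <;> cases t <;> simp_all [EvenGen.code, Fin.ext_iff]

theorem OddGen.code_injective (n : ℕ) : Function.Injective (OddGen.code (n := n)) := by
  intro s t h
  cases s <;> cases t <;> simp_all [OddGen.code, Fin.ext_iff]

instance EvenGen.linearOrder (n : ℕ) : LinearOrder (EvenGen n) :=
  LinearOrder.lift' EvenGen.code (EvenGen.code_injective n)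

instance OddGen.linearOrder (n : ℕ) : LinearOrder (OddGen n) :=
  LinearOrder.lift' OddGen.code (OddGen.code_injective n)

/-- The pair `(a, m)` labels the creation mode `a_(-m-1)`, i.e. the field `∂ ^ m a / m!`. -/
abbrev EvenMode (n : ℕ) : Type := EvenGen n ×ₗ ℕ

/-- The pair `(a, m)` labels the creation mode `a_(-m-1)`, i.e. the field `∂ ^ m a / m!`. -/
abbrev OddMode (n : ℕ) : Type := OddGen n ×ₗ ℕ

/-- Labels of the basis of the Fock space: occupation numbers of the bosonic creation modes and
the finite set of occupied fermionic creation modes. -/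
abbrev Occ (n : ℕ) : Type := (EvenMode n →₀ ℕ) × Finset (OddMode n)

/-- The Fock space.  The basis vector labelled by `(m, {s₁ < s₂ < ⋯})` is the product of the bosonic
creation modes given by `m` and of the fermionic ones `s₁ s₂ ⋯` (in this order),
applied to the vacuum. -/
abbrev Fock (n : ℕ) : Type := Occ n →₀ ℂ

variable {n : ℕ}

/-- The vacuum vector, i.e. the identity operator. -/
def vac : Fock n := Finsupp.single (0, ∅) 1

/-- Multiplication by a bosonic creation mode. -/
def evenCre (s : EvenMode n) : Fock n →ₗ[ℂ] Fock n :=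
  Finsupp.linearCombination ℂ fun o : Occ n =>
    (Finsupp.single (o.1 + Finsupp.single s 1, o.2) (1 : ℂ) : Fock n)

/-- The derivative with respect to a bosonic creation mode. -/
def evenAnn (s : EvenMode n) : Fock n →ₗ[ℂ] Fock n :=
  Finsupp.linearCombination ℂ fun o : Occ n =>
    (Finsupp.single (o.1 - Finsupp.single s 1, o.2) (o.1 s : ℂ) : Fock n)

/-- The sign for moving the fermionic mode `s` past the modes of `S` that precede it. -/
def oddSign (s : OddMode n) (S : Finset (OddMode n)) : ℂ :=
  (-1) ^ (S.filter (fun t => t < s)).card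

/-- Left multiplication by a fermionic creation mode. -/
def oddCre (s : OddMode n) : Fock n →ₗ[ℂ] Fock n :=
  Finsupp.linearCombination ℂ fun o : Occ n =>
    if s ∈ o.2 then (0 : Fock n) else Finsupp.single (o.1, insert s o.2) (oddSign s o.2)

/-- The left (odd) derivative with respect to a fermionic creation mode. -/
def oddAnn (s : OddMode n) : Fock n →ₗ[ℂ] Fock n :=
  Finsupp.linearCombination ℂ fun o : Occ n =>
    if s ∈ o.2 then Finsupp.single (o.1, o.2.erase s) (oddSign s o.2) else (0 : Fock n)

/-- The mode `a_(k)` of a bosonic generating field `a(z) = ∑ a_(k) z ^ (-k-1)`; the nonnegative modes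
encode `X(z) Y(0) ~ 1 / z` and `Y(z) X(0) ~ -1 / z`. -/
def evenMode (a : EvenGen n) : ℤ → (Fock n →ₗ[ℂ] Fock n)
  | Int.negSucc m => evenCre (toLex (a, m))
  | Int.ofNat m =>
    match a with
    | .X i => evenAnn (toLex (.Y i, m))
    | .Y i => -evenAnn (toLex (.X i, m))

/-- The mode `a_(k)` of a fermionic generating field; the nonnegative modes encode
`psi(z) chi(0) ~ chi(z) psi(0) ~ 1 / z` and `b(z) c(0) ~ c(z) b(0) ~ 1 / z`. -/
def oddMode (a : OddGen n) : ℤ → (Fock n →ₗ[ℂ] Fock n)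
  | Int.negSucc m => oddCre (toLex (a, m))
  | Int.ofNat m =>
    match a with
    | .psi i => oddAnn (toLex (.chi i, m))
    | .chi i => oddAnn (toLex (.psi i, m))
    | .b i => oddAnn (toLex (.c i, m))
    | .c i => oddAnn (toLex (.b i, m))

/-! ### The state-field correspondence -/

/-- A letter is a generating field with a number `m` of (divided) derivatives. -/
abbrev Letter (n : ℕ) : Type := EvenMode n ⊕ OddMode n

/-- The `k`-th mode of the field `∂ ^ m a / m!`, namely `(-1) ^ m * (k choose m) * a_(k-m)`. -/
def letterMode (s : Letter n) (k : ℤ) : Fock n →ₗ[ℂ] Fock n :=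
  match s with
  | .inl p => ((((-1) ^ (ofLex p).2 * Ring.choose k (ofLex p).2 : ℤ)) : ℂ) •
      evenMode (ofLex p).1 (k - (ofLex p).2)
  | .inr p => ((((-1) ^ (ofLex p).2 * Ring.choose k (ofLex p).2 : ℤ)) : ℂ) •
      oddMode (ofLex p).1 (k - (ofLex p).2)

/-- The sign for exchanging the letter `s` with the word `l`. -/
def letterSign (s : Letter n) (l : List (Letter n)) : ℂ :=
  if s.isRight then (-1) ^ (l.filter (fun t => t.isRight)).length else 1

/-- The `k`-th mode of the nested normally ordered product of the letters of a word, through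
`:A F:_(k) = ∑_{j ≥ 0} (A_(-1-j) F_(k+j) + (-1) ^ (|A| |F|) F_(k-1-j) A_(j))`.
On every vector only finitely many terms are nonzero. -/
def wordMode : List (Letter n) → ℤ → Fock n → Fock n
  | [], k, v => if k = -1 then v else 0
  | s :: l, k, v =>
      (∑ᶠ j : ℕ, letterMode s (-1 - j) (wordMode l (k + j) v)) +
        letterSign s l • ∑ᶠ j : ℕ, wordMode l (k - 1 - j) (letterMode s j v)

/-- The creation modes of a basis vector, in the order in which they occur in it. -/
def Occ.word (o : Occ n) : List (Letter n) :=
  ((Finsupp.toMultiset o.1).sort (· ≤ ·)).map Sum.inl ++ (o.2.sort (· ≤ ·)).map Sum.inr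

/-- The mode `u_(k) v` of the field of the state `u`, applied to the state `v`. -/
def mode (u : Fock n) (k : ℤ) (v : Fock n) : Fock n :=
  u.sum fun o z => z • wordMode o.word k v

/-- The product `(A B)_p (w) = ∮ dz / (2 π i) (z - w) ^ (p - 1) A(z) B(w)`. -/
def opProd (p : ℤ) (A B : Fock n) : Fock n := mode A (p - 1) B

/-- The normally ordered product `(A B)_0`. -/
def nop (A B : Fock n) : Fock n := opProd 0 A B

/-- The derivative `∂ A`, as `A_(-2)` applied to the vacuum. -/
def deriv (A : Fock n) : Fock n := mode A (-2) vac

/-! ### Generating operators and the BRST charge -/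

def opX (i : Fin n) : Fock n := evenMode (.X i) (-1) vac
def opY (i : Fin n) : Fock n := evenMode (.Y i) (-1) vac
def opPsi (i : Fin n) : Fock n := oddMode (.psi i) (-1) vac
def opChi (i : Fin n) : Fock n := oddMode (.chi i) (-1) vac
def opC (a : Fin (n - 1)) : Fock n := oddMode (.c a) (-1) vac

/-- The current `X i Y i + psi i chi i`. -/
def current (i : Fin n) : Fock n := nop (opX i) (opY i) + nop (opPsi i) (opChi i)

/-- The BRST current
`∑_{a = 1}^{n - 1} c^a (X_a Y_a - X_{a+1} Y_{a+1} + psi_a chi_a - psi_{a+1} chi_{a+1})`. -/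
def brstCurrent (n : ℕ) : Fock n :=
  ∑ a : Fin (n - 1),
    nop (opC a) (current ⟨a.val, by have := a.isLt; omega⟩ -
      current ⟨a.val + 1, by have := a.isLt; omega⟩)

/-- The BRST charge `∮ dz / (2 π i) J_BRST(z)`. -/
def Q (v : Fock n) : Fock n := mode (brstCurrent n) 0 v

/-- `A ≡ B`: the difference is `Q`-exact. -/
def Equivalent (A B : Fock n) : Prop := ∃ w : Fock n, A - B = Q w

/-! ### Covariant derivatives -/

/-- `𝒜_i = -X_i Y_i`. -/
def calA (i : Fin n) : Fock n := -nop (opX i) (opY i)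

/-- `𝒟_i O = (𝒜_i O)_0 + (X_i (Y_i O)_0)_0`. -/
def partialD (i : Fin n) (v : Fock n) : Fock n :=
  nop (calA i) v + nop (opX i) (nop (opY i) v)

/-- `D_i O = 𝒟_i O + (𝒜_i O)_0`. -/
def covD (i : Fin n) (v : Fock n) : Fock n := partialD i v + nop (calA i) v

/-- `∏_{j ∈ J} D_j`; the operators `D_j` commute, and are applied here in a fixed order. -/
def covDProd (J : Finset (Fin n)) (v : Fock n) : Fock n := (J.sort (· ≤ ·)).foldr covD v

/-! ### The operators of the bosonic and of the boundary vertex algebra -/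

/-- The nested normally ordered product `A_1 A_2 ⋯ A_n`. -/
def nestedProd (A : Fin n → Fock n) : Fock n := (List.finRange n).foldr (fun i v => nop (A i) v) vac

/-- `𝒳_I = ∏_{i ∈ I} D_i (X_1 ⋯ X_n)`. -/
def calX (I : Finset (Fin n)) : Fock n := covDProd I (nestedProd opX)

/-- `𝒴_I = ∏_{i ∈ I} D_i (Y_1 ⋯ Y_n)`. -/
def calY (I : Finset (Fin n)) : Fock n := covDProd I (nestedProd opY)

/-- `U = -(1 / n) ∑ X_i Y_i`. -/
def opU (n : ℕ) : Fock n := -((1 / n : ℂ) • ∑ i : Fin n, nop (opX i) (opY i))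

/-- `U_F = -(1 / n) ∑ psi_i chi_i`. -/
def opUF (n : ℕ) : Fock n := -((1 / n : ℂ) • ∑ i : Fin n, nop (opPsi i) (opChi i))

/-- `M_i^+ = X_i psi_i`. -/
def opMplus (i : Fin n) : Fock n := nop (opX i) (opPsi i)

/-- `M_i^- = Y_i chi_i`. -/
def opMminus (i : Fin n) : Fock n := nop (opY i) (opChi i)

/-- `A_1 ⋯ A_n` with `A_i = chi_i` for `i ∈ I` and `A_i = X_i` otherwise. -/
def hatX (I : Finset (Fin n)) : Fock n := nestedProd fun i => if i ∈ I then opChi i else opX i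

/-- `B_1 ⋯ B_n` with `B_i = psi_i` for `i ∈ I` and `B_i = Y_i` otherwise. -/
def hatY (I : Finset (Fin n)) : Fock n := nestedProd fun i => if i ∈ I then opPsi i else opY i

/-- `∏_{j ∈ J} D_j` applied to `hatX I`. -/
def hatX₂ (I J : Finset (Fin n)) : Fock n := covDProd J (hatX I)

/-- `∏_{j ∈ J} D_j` applied to `hatY I`. -/
def hatY₂ (I J : Finset (Fin n)) : Fock n := covDProd J (hatY I)

/-- The number of fermions `chi_k` (resp. `psi_k`) with `k < j` in `hatX I` (resp. `hatY I`); the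
bosonic operators `D_k` do not change it. -/
def fermionCount (I : Finset (Fin n)) (j : Fin n) : ℕ := (I.filter (fun k => k < j)).card

/-- The generators `U`, `U_F`, `M_i^±`, `hatX I`, `hatY I` of the boundary vertex algebra. -/
def generators (n : ℕ) : Set (Fock n) :=
  {opU n, opUF n} ∪ Set.range opMplus ∪ Set.range opMminus ∪ Set.range hatX ∪ Set.range hatY

/-- Linear combinations of iterated normally ordered products of elements of `G` and of their
derivatives. -/
inductive IsNormallyOrderedPolynomial (G : Set (Fock n)) : Fock n → Prop
  | vac : IsNormallyOrderedPolynomial G vac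
  | mem (A : Fock n) : A ∈ G → IsNormallyOrderedPolynomial G A
  | add (A B : Fock n) : IsNormallyOrderedPolynomial G A → IsNormallyOrderedPolynomial G B →
      IsNormallyOrderedPolynomial G (A + B)
  | smul (z : ℂ) (A : Fock n) : IsNormallyOrderedPolynomial G A →
      IsNormallyOrderedPolynomial G (z • A)
  | deriv (A : Fock n) : IsNormallyOrderedPolynomial G A →
      IsNormallyOrderedPolynomial G (deriv A)
  | nop (A B : Fock n) : IsNormallyOrderedPolynomial G A → IsNormallyOrderedPolynomial G B →
      IsNormallyOrderedPolynomial G (nop A B)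

end BoundaryVOA

end

/-! Write `J_i = X_i Y_i + psi_i chi_i`. These currents commute with one another: the central terms
of the bosonic and the fermionic bilinear have opposite signs and cancel (`cur_cur`). They also
commute with the `c` ghosts and with `M_i^±`. The BRST current is the sum of `c^a (J_a - J_{a+1})`.
If `v` is killed by the nonnegative modes of every `c^a` and of every difference `J_i - J_j`, then
only the contraction of `c^a` with `b_a` survives in `Q (b_a v)`, which equals `(J_a - J_{a+1}) v`
(`brst_b`). Hence all products `J_i v` are equivalent, and averaging over `i` makes each `-J_j v`
equivalent to `(U + U_F) v`.

The recursion then comes from an exact identity at one site. Let `w` be annihilated by the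
nonnegative modes of the matter fields of index `j`. Then `D_j (X_j w) = -J_j (X_j w) + M_j^+ (chi_j
w)`, and `D_j (Y_j w) = -J_j (Y_j w) - M_j^- (psi_j w)` (`AnnihilatedAt.covD_boson_eq`). The
products in question have this form with a common `w`, up to the sign of moving the fermion to the
front (`exists_hat₂_eq`). They satisfy the hypothesis on `v` because every `J_i` acts on them with
the same charge and without higher poles (`cur_hat₂`).

For (2) the recursion is iterated, each step removing one covariant derivative. This needs exactness
to survive multiplication by `U + U_F` and `M_j^±`. It does so on the span `currentExact` of the
states `(J_i - J_j) v`, since these operators commute with the currents and preserve the admissible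
`v`. -/

noncomputable section

namespace BoundaryVOA

variable {n : ℕ}

/-! ### Creation and annihilation operators -/

/-- The basis vectors of the Fock space. -/
def ket (o : Occ n) : Fock n := Finsupp.single o 1

theorem linearMap_ext_ket {f g : Fock n →ₗ[ℂ] Fock n} (h : ∀ o, f (ket o) = g (ket o)) : f = g := by
  refine Finsupp.lhom_ext' fun o => LinearMap.ext_ring ?_
  simpa [ket] using h o

theorem evenCre_ket (s : EvenMode n) (o : Occ n) :
    evenCre s (ket o) = ket (o.1 + Finsupp.single s 1, o.2) := by
  simp [evenCre, ket]

theorem evenAnn_ket (s : EvenMode n) (o : Occ n) :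
    evenAnn s (ket o) = (o.1 s : ℂ) • ket (o.1 - Finsupp.single s 1, o.2) := by
  simp [evenAnn, ket]

theorem oddCre_ket (s : OddMode n) (o : Occ n) :
    oddCre s (ket o) = if s ∈ o.2 then 0 else oddSign s o.2 • ket (o.1, insert s o.2) := by
  simp [oddCre, ket]

theorem oddAnn_ket (s : OddMode n) (o : Occ n) :
    oddAnn s (ket o) = if s ∈ o.2 then oddSign s o.2 • ket (o.1, o.2.erase s) else 0 := by
  simp [oddAnn, ket]

theorem evenCre_evenCre (s t : EvenMode n) : evenCre s * evenCre t = evenCre t * evenCre s := by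
  refine linearMap_ext_ket fun o => ?_
  simp [Module.End.mul_apply, evenCre_ket, add_assoc, add_comm (Finsupp.single s 1)]

theorem evenAnn_evenAnn (s t : EvenMode n) : evenAnn s * evenAnn t = evenAnn t * evenAnn s := by
  refine linearMap_ext_ket fun o => ?_
  rcases eq_or_ne s t with rfl | h
  · rfl
  simp [Module.End.mul_apply, evenAnn_ket, smul_smul, tsub_tsub, add_comm (Finsupp.single s 1),
    h, h.symm, mul_comm]

theorem evenAnn_evenCre (s t : EvenMode n) :
    evenAnn s * evenCre t = evenCre t * evenAnn s + if s = t then 1 else 0 := by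
  refine linearMap_ext_ket fun o => ?_
  rcases eq_or_ne s t with rfl | h
  · have hs : (o.1 s : ℂ) • ket (o.1 - Finsupp.single s 1 + Finsupp.single s 1, o.2) =
        (o.1 s : ℂ) • ket o := by
      rcases Nat.eq_zero_or_pos (o.1 s) with h0 | h0
      · simp [h0]
      · rw [tsub_add_cancel_of_le]
        rw [Finsupp.single_le_iff]
        exact h0
    simp [Module.End.mul_apply, evenAnn_ket, evenCre_ket, hs, add_smul]
  · have e : (o.1 s : ℂ) • ket (o.1 + Finsupp.single t 1 - Finsupp.single s 1, o.2) =
        (o.1 s : ℂ) • ket (o.1 - Finsupp.single s 1 + Finsupp.single t 1, o.2) := by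
      rcases Nat.eq_zero_or_pos (o.1 s) with h0 | h0
      · simp [h0]
      · rw [tsub_add_eq_add_tsub]
        rw [Finsupp.single_le_iff]
        exact h0
    simp [Module.End.mul_apply, evenAnn_ket, evenCre_ket, h, e]

theorem evenCre_oddCre (s : EvenMode n) (t : OddMode n) :
    evenCre s * oddCre t = oddCre t * evenCre s := by
  refine linearMap_ext_ket fun o => ?_
  by_cases h : t ∈ o.2 <;> simp [Module.End.mul_apply, evenCre_ket, oddCre_ket, h]

theorem evenCre_oddAnn (s : EvenMode n) (t : OddMode n) :
    evenCre s * oddAnn t = oddAnn t * evenCre s := by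
  refine linearMap_ext_ket fun o => ?_
  by_cases h : t ∈ o.2 <;> simp [Module.End.mul_apply, evenCre_ket, oddAnn_ket, h]

theorem evenAnn_oddCre (s : EvenMode n) (t : OddMode n) :
    evenAnn s * oddCre t = oddCre t * evenAnn s := by
  refine linearMap_ext_ket fun o => ?_
  by_cases h : t ∈ o.2 <;>
    simp [Module.End.mul_apply, evenAnn_ket, oddCre_ket, h, smul_smul, mul_comm]

theorem evenAnn_oddAnn (s : EvenMode n) (t : OddMode n) :
    evenAnn s * oddAnn t = oddAnn t * evenAnn s := by
  refine linearMap_ext_ket fun o => ?_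
  by_cases h : t ∈ o.2 <;>
    simp [Module.End.mul_apply, evenAnn_ket, oddAnn_ket, h, smul_smul, mul_comm]

theorem oddSign_mul_self (s : OddMode n) (S : Finset (OddMode n)) :
    oddSign s S * oddSign s S = 1 := by
  rw [oddSign, ← mul_pow]
  simp

theorem oddSign_insert (s t : OddMode n) {S : Finset (OddMode n)} (h : t ∉ S) :
    oddSign s (insert t S) = (if t < s then -1 else 1) * oddSign s S := by
  unfold oddSign
  rw [Finset.filter_insert]
  split_ifs
  · rw [Finset.card_insert_of_notMem (by simp [h]), pow_succ']
  · simp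

theorem oddSign_erase (s t : OddMode n) {S : Finset (OddMode n)} (h : t ∈ S) :
    oddSign s (S.erase t) = (if t < s then -1 else 1) * oddSign s S := by
  conv_rhs => rw [← Finset.insert_erase h, oddSign_insert s t (Finset.notMem_erase t S)]
  split_ifs <;> simp

theorem oddCre_oddCre (s t : OddMode n) : oddCre s * oddCre t = -(oddCre t * oddCre s) := by
  refine linearMap_ext_ket fun o => ?_
  rcases eq_or_ne s t with rfl | hst
  · by_cases h : s ∈ o.2 <;> simp [Module.End.mul_apply, oddCre_ket, h]
  · by_cases h : s ∈ o.2 <;> by_cases h' : t ∈ o.2 <;>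
      simp [Module.End.mul_apply, oddCre_ket, h, h', hst, hst.symm, smul_smul, oddSign_insert]
    rw [Finset.insert_comm, mul_comm]
    -- Exactly one of `s < t` and `t < s` holds, so exactly one of the two orders picks up the extra
    -- sign.
    rcases lt_or_gt_of_ne hst with h | h <;> simp [h, h.not_gt]

theorem oddAnn_oddAnn (s t : OddMode n) : oddAnn s * oddAnn t = -(oddAnn t * oddAnn s) := by
  refine linearMap_ext_ket fun o => ?_
  rcases eq_or_ne s t with rfl | hst
  · by_cases h : s ∈ o.2 <;> simp [Module.End.mul_apply, oddAnn_ket, h]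
  · by_cases h : s ∈ o.2 <;> by_cases h' : t ∈ o.2 <;>
      simp [Module.End.mul_apply, oddAnn_ket, h, h', hst, hst.symm, smul_smul, oddSign_erase]
    rw [Finset.erase_right_comm, mul_comm]
    rcases lt_or_gt_of_ne hst with h | h <;> simp [h, h.not_gt]

theorem oddAnn_oddCre (s t : OddMode n) :
    oddAnn s * oddCre t = -(oddCre t * oddAnn s) + if s = t then 1 else 0 := by
  refine linearMap_ext_ket fun o => ?_
  rcases eq_or_ne s t with rfl | hst
  · by_cases h : s ∈ o.2
    · simp [Module.End.mul_apply, oddCre_ket, oddAnn_ket, h, smul_smul, oddSign_erase,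
        oddSign_mul_self, Finset.insert_erase]
    · simp [Module.End.mul_apply, oddCre_ket, oddAnn_ket, h, smul_smul, oddSign_insert,
        oddSign_mul_self]
  · by_cases h : s ∈ o.2 <;> by_cases h' : t ∈ o.2 <;>
      simp [Module.End.mul_apply, oddCre_ket, oddAnn_ket, h, h', hst, hst.symm, smul_smul,
        oddSign_insert, oddSign_erase]
    rw [Finset.erase_insert_of_ne hst.symm, mul_comm]
    rcases lt_or_gt_of_ne hst with h | h <;> simp [h, h.not_gt]

/-! ### Modes of the generating fields -/

/-- The coefficient of `1 / z` in the operator product expansion of two bosonic generators. -/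
def evenPairing : EvenGen n → EvenGen n → ℂ
  | .X i, .Y j => if i = j then 1 else 0
  | .Y i, .X j => if i = j then -1 else 0
  | _, _ => 0

/-- The coefficient of `1 / z` in the operator product expansion of two fermionic generators. -/
def oddPairing : OddGen n → OddGen n → ℂ
  | .psi i, .chi j => if i = j then 1 else 0
  | .chi i, .psi j => if i = j then 1 else 0
  | .b i, .c j => if i = j then 1 else 0
  | .c i, .b j => if i = j then 1 else 0
  | _, _ => 0

/-- The operator product expansion in terms of modes. Since the label `m` stands for the creation
mode of index `-m-1`, labels of a creation and an annihilation mode match exactly when the indices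
add up to `-1`. -/
theorem evenMode_evenMode (a b : EvenGen n) (p q : ℤ) (v : Fock n) :
    evenMode a p (evenMode b q v) = evenMode b q (evenMode a p v) +
      (if p + q = -1 then evenPairing a b else 0) • v := by
  have aa : ∀ s t : EvenMode n, evenAnn s (evenAnn t v) = evenAnn t (evenAnn s v) := fun s t =>
    LinearMap.congr_fun (evenAnn_evenAnn s t) v
  have cc : ∀ s t : EvenMode n, evenCre s (evenCre t v) = evenCre t (evenCre s v) := fun s t =>
    LinearMap.congr_fun (evenCre_evenCre s t) v
  have ac : ∀ s t : EvenMode n, evenAnn s (evenCre t v) =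
      evenCre t (evenAnn s v) + if s = t then v else 0 := fun s t => by
    have := LinearMap.congr_fun (evenAnn_evenCre s t) v
    rw [Module.End.mul_apply] at this
    rw [this]
    split_ifs <;> simp
  have e1 : ∀ p q : ℕ, ((p : ℤ) + Int.negSucc q = -1) ↔ p = q := fun p q => by omega
  have e2 : ∀ p q : ℕ, (Int.negSucc p + (q : ℤ) = -1) ↔ q = p := fun p q => by omega
  have e3 : ∀ p q : ℕ, ¬ ((p : ℤ) + q = -1) := fun p q => by omega
  have e4 : ∀ p q : ℕ, ¬ (Int.negSucc p + Int.negSucc q = -1) := fun p q => by omega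
  rcases p with p | p <;> rcases q with q | q
  · cases a <;> cases b <;> simp [evenMode, e3, aa (toLex (_, p)) (toLex (_, q))]
  · cases a <;> cases b <;> simp [evenMode, evenPairing, e1, ac]
    all_goals split_ifs <;> grind
  · cases a <;> cases b <;> simp [evenMode, evenPairing, e2, ac]
    all_goals split_ifs <;> grind
  · simp [evenMode, e4, cc (toLex (_, p)) (toLex (_, q))]

theorem oddMode_oddMode (a b : OddGen n) (p q : ℤ) (v : Fock n) :
    oddMode a p (oddMode b q v) = -oddMode b q (oddMode a p v) +
      (if p + q = -1 then oddPairing a b else 0) • v := by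
  have aa : ∀ s t : OddMode n, oddAnn s (oddAnn t v) = -oddAnn t (oddAnn s v) := fun s t =>
    LinearMap.congr_fun (oddAnn_oddAnn s t) v
  have cc : ∀ s t : OddMode n, oddCre s (oddCre t v) = -oddCre t (oddCre s v) := fun s t =>
    LinearMap.congr_fun (oddCre_oddCre s t) v
  have ac : ∀ s t : OddMode n, oddAnn s (oddCre t v) =
      -oddCre t (oddAnn s v) + if s = t then v else 0 := fun s t => by
    have := LinearMap.congr_fun (oddAnn_oddCre s t) v
    rw [Module.End.mul_apply] at this
    rw [this]
    split_ifs <;> simp [Module.End.mul_apply]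
  have e1 : ∀ p q : ℕ, ((p : ℤ) + Int.negSucc q = -1) ↔ p = q := fun p q => by omega
  have e2 : ∀ p q : ℕ, (Int.negSucc p + (q : ℤ) = -1) ↔ q = p := fun p q => by omega
  have e3 : ∀ p q : ℕ, ¬ ((p : ℤ) + q = -1) := fun p q => by omega
  have e4 : ∀ p q : ℕ, ¬ (Int.negSucc p + Int.negSucc q = -1) := fun p q => by omega
  rcases p with p | p <;> rcases q with q | q
  · cases a <;> cases b <;> simp [oddMode, e3, aa (toLex (_, p)) (toLex (_, q))]
  · cases a <;> cases b <;> simp [oddMode, oddPairing, e1, ac]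
    all_goals split_ifs <;> grind
  · cases a <;> cases b <;> simp [oddMode, oddPairing, e2, ac]
    all_goals split_ifs <;> grind
  · simp [oddMode, e4, cc (toLex (_, p)) (toLex (_, q))]

theorem evenMode_oddMode (a : EvenGen n) (b : OddGen n) (p q : ℤ) (v : Fock n) :
    evenMode a p (oddMode b q v) = oddMode b q (evenMode a p v) := by
  have h1 := fun (s : EvenMode n) (t : OddMode n) => LinearMap.congr_fun (evenCre_oddCre s t) v
  have h2 := fun (s : EvenMode n) (t : OddMode n) => LinearMap.congr_fun (evenCre_oddAnn s t) v
  have h3 := fun (s : EvenMode n) (t : OddMode n) => LinearMap.congr_fun (evenAnn_oddCre s t) v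
  have h4 := fun (s : EvenMode n) (t : OddMode n) => LinearMap.congr_fun (evenAnn_oddAnn s t) v
  simp only [Module.End.mul_apply] at h1 h2 h3 h4
  rcases p with p | p <;> rcases q with q | q <;> cases a <;> cases b <;>
    simp [evenMode, oddMode, h1, h2, h3, h4]

theorem evenMode_vac (a : EvenGen n) (p : ℕ) : evenMode a p vac = 0 := by
  have h : ∀ s : EvenMode n, evenAnn s vac = 0 := fun s => by
    simpa [ket, vac] using evenAnn_ket s (0, ∅)
  cases a <;> simp [evenMode, h]

theorem oddMode_vac (a : OddGen n) (p : ℕ) : oddMode a p vac = 0 := by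
  have h : ∀ s : OddMode n, oddAnn s vac = 0 := fun s => by
    simpa [ket, vac] using oddAnn_ket s (0, ∅)
  cases a <;> simp [oddMode, h]

theorem exists_ann_eq_zero (f : ℕ → Fock n →ₗ[ℂ] Fock n)
    (hf : ∀ o, ∃ N, ∀ k ≥ N, f k (ket o) = 0) (v : Fock n) : ∃ N, ∀ k ≥ N, f k v = 0 := by
  induction v using Finsupp.induction_linear with
  | zero => exact ⟨0, fun k _ => map_zero _⟩
  | add v w hv hw =>
    obtain ⟨N, hN⟩ := hv
    obtain ⟨M, hM⟩ := hw
    exact ⟨max N M, fun k hk => by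
      rw [map_add, hN k (le_trans (le_max_left _ _) hk), hM k (le_trans (le_max_right _ _) hk),
        add_zero]⟩
  | single o z =>
    obtain ⟨N, hN⟩ := hf o
    refine ⟨N, fun k hk => ?_⟩
    have : (Finsupp.single o z : Fock n) = z • ket o := by simp [ket]
    rw [this, map_smul, hN k hk, smul_zero]

theorem evenAnn_eventually (a : EvenGen n) (v : Fock n) :
    ∃ N : ℕ, ∀ k ≥ N, evenAnn (toLex (a, k)) v = 0 := by
  refine exists_ann_eq_zero (fun k => evenAnn (toLex (a, k))) (fun o => ?_) v
  refine ⟨(o.1.support.image fun s => (ofLex s).2).sup id + 1, fun k hk => ?_⟩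
  have : o.1 (toLex (a, k)) = 0 := by
    by_contra h
    have h' : k ∈ o.1.support.image fun s => (ofLex s).2 :=
      Finset.mem_image.2 ⟨toLex (a, k), Finsupp.mem_support_iff.2 h, rfl⟩
    have := Finset.le_sup (f := id) h'
    simp only [id] at this
    omega
  simp [evenAnn_ket, this]

theorem oddAnn_eventually (a : OddGen n) (v : Fock n) :
    ∃ N : ℕ, ∀ k ≥ N, oddAnn (toLex (a, k)) v = 0 := by
  refine exists_ann_eq_zero (fun k => oddAnn (toLex (a, k))) (fun o => ?_) v
  refine ⟨(o.2.image fun s => (ofLex s).2).sup id + 1, fun k hk => ?_⟩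
  have : toLex (a, k) ∉ o.2 := by
    intro h
    have h' : k ∈ o.2.image fun s => (ofLex s).2 :=
      Finset.mem_image.2 ⟨toLex (a, k), h, rfl⟩
    have := Finset.le_sup (f := id) h'
    simp only [id] at this
    omega
  simp [oddAnn_ket, this]

/-! ### Fields -/

/-- The fields: families of modes such that on every vector the modes of large index vanish. -/
def fields (n : ℕ) : Submodule ℂ (ℤ → Fock n →ₗ[ℂ] Fock n) where
  carrier := {s | ∀ v, ∃ N : ℤ, ∀ k ≥ N, s k v = 0}
  zero_mem' := fun v => ⟨0, fun k _ => rfl⟩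
  add_mem' := fun {s t} hs ht v => by
    obtain ⟨N, hN⟩ := hs v
    obtain ⟨M, hM⟩ := ht v
    exact ⟨max N M, fun k hk => by
      simp [hN k (le_trans (le_max_left _ _) hk), hM k (le_trans (le_max_right _ _) hk)]⟩
  smul_mem' := fun z s hs v => by
    obtain ⟨N, hN⟩ := hs v
    exact ⟨N, fun k hk => by simp [hN k hk]⟩

theorem evenMode_mem_fields (a : EvenGen n) : evenMode a ∈ fields n := by
  intro v
  have : ∃ N : ℕ, ∀ k ≥ N, evenMode a (Int.ofNat k) v = 0 := by
    cases a with
    | X i => exact evenAnn_eventually (.Y i) v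
    | Y i =>
      obtain ⟨N, hN⟩ := evenAnn_eventually (.X i) v
      exact ⟨N, fun k hk => by simp [evenMode, hN k hk]⟩
  obtain ⟨N, hN⟩ := this
  refine ⟨N, fun k hk => ?_⟩
  lift k to ℕ using by omega
  exact hN k (by omega)

theorem oddMode_mem_fields (a : OddGen n) : oddMode a ∈ fields n := by
  intro v
  have : ∃ N : ℕ, ∀ k ≥ N, oddMode a (Int.ofNat k) v = 0 := by
    cases a with
    | psi i => exact oddAnn_eventually (.chi i) v
    | chi i => exact oddAnn_eventually (.psi i) v
    | b i => exact oddAnn_eventually (.c i) v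
    | c i => exact oddAnn_eventually (.b i) v
  obtain ⟨N, hN⟩ := this
  refine ⟨N, fun k hk => ?_⟩
  lift k to ℕ using by omega
  exact hN k (by omega)

/-! ### Normally ordered products of fields -/

theorem exists_nat_bound (s : fields n) (k : ℤ) (v : Fock n) :
    ∃ N : ℕ, ∀ j : ℕ, N ≤ j → s.1 (k + j) v = 0 := by
  obtain ⟨N, hN⟩ := s.2 v
  exact ⟨(N - k).toNat, fun j hj => hN _ (by omega)⟩

/-- The bound is uniform in `j` because only finitely many of the vectors `s_j v` are nonzero. This
is what makes a normally ordered product a field again. -/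
theorem exists_bound_comp (s t : fields n) (v : Fock n) :
    ∃ N : ℤ, ∀ j : ℕ, ∀ m ≥ N, t.1 (m - j) (s.1 j v) = 0 := by
  obtain ⟨M, hM⟩ := exists_nat_bound s 0 v
  have key : ∀ M : ℕ, ∃ N : ℤ, ∀ j < M, ∀ m ≥ N, t.1 (m - j) (s.1 j v) = 0 := by
    intro M
    induction M with
    | zero => exact ⟨0, by simp⟩
    | succ M ih =>
      obtain ⟨N, hN⟩ := ih
      obtain ⟨N', hN'⟩ := t.2 (s.1 M v)
      refine ⟨max N (N' + M), fun j hj m hm => ?_⟩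
      rcases Nat.lt_succ_iff_lt_or_eq.1 hj with h | rfl
      · exact hN j h m (le_trans (le_max_left _ _) hm)
      · exact hN' _ (by have := le_trans (le_max_right _ _) hm; omega)
  obtain ⟨N, hN⟩ := key M
  refine ⟨N, fun j m hm => ?_⟩
  rcases lt_or_ge j M with h | h
  · exact hN j h m hm
  · have := hM j h
    rw [zero_add] at this
    rw [this, map_zero]

/-- The `k`-th mode of the normally ordered product of `s` and `t`, where `ε` is the sign for
exchanging the two fields. -/
def nordFun (ε : ℂ) (s t : ℤ → Fock n →ₗ[ℂ] Fock n) (k : ℤ) (v : Fock n) : Fock n :=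
  (∑ᶠ j : ℕ, s (-1 - j) (t (k + j) v)) + ε • ∑ᶠ j : ℕ, t (k - 1 - j) (s j v)

theorem finsum_eq_sum_range {M : Type*} [AddCommMonoid M] {f : ℕ → M} {N : ℕ}
    (h : ∀ j, N ≤ j → f j = 0) : ∑ᶠ j, f j = ∑ j ∈ Finset.range N, f j :=
  finsum_eq_sum_of_support_subset _ fun j hj => by
    by_contra h'
    exact hj (h j (by simpa using h'))

/-- The truncations are free as long as they are large enough, so several products can be cut off at
a common bound and compared as finite sums. -/
theorem nordFun_eq_sum (ε : ℂ) {s t : ℤ → Fock n →ₗ[ℂ] Fock n} {k : ℤ} {v : Fock n} {A B : ℕ}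
    (hA : ∀ j : ℕ, A ≤ j → t (k + j) v = 0) (hB : ∀ j : ℕ, B ≤ j → s j v = 0) :
    nordFun ε s t k v = (∑ j ∈ Finset.range A, s (-1 - j) (t (k + j) v)) +
      ε • ∑ j ∈ Finset.range B, t (k - 1 - j) (s j v) := by
  rw [nordFun, finsum_eq_sum_range fun j hj => by rw [hA j hj, map_zero],
    finsum_eq_sum_range fun j hj => by rw [hB j hj, map_zero]]

theorem exists_bounds (s t : fields n) (k : ℤ) (v : Fock n) :
    ∃ N : ℕ, ∀ j : ℕ, N ≤ j → t.1 (k + j) v = 0 ∧ s.1 j v = 0 := by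
  obtain ⟨A, hA⟩ := exists_nat_bound t k v
  obtain ⟨B, hB⟩ := exists_nat_bound s 0 v
  exact ⟨max A B, fun j hj => ⟨hA j (le_trans (le_max_left _ _) hj), by
    simpa using hB j (le_trans (le_max_right _ _) hj)⟩⟩

/-- The normally ordered product of two fields. -/
def nord (ε : ℂ) (s t : fields n) : fields n where
  val k :=
    { toFun := nordFun ε s.1 t.1 k
      map_add' := fun v w => by
        obtain ⟨N, hN⟩ := exists_bounds s t k v
        obtain ⟨M, hM⟩ := exists_bounds s t k w
        have hv : ∀ j : ℕ, max N M ≤ j → t.1 (k + j) v = 0 ∧ s.1 j v = 0 :=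
          fun j hj => hN j (le_trans (le_max_left _ _) hj)
        have hw : ∀ j : ℕ, max N M ≤ j → t.1 (k + j) w = 0 ∧ s.1 j w = 0 :=
          fun j hj => hM j (le_trans (le_max_right _ _) hj)
        rw [nordFun_eq_sum (A := max N M) (B := max N M) ε (fun j hj => (hv j hj).1)
            (fun j hj => (hv j hj).2),
          nordFun_eq_sum (A := max N M) (B := max N M) ε (fun j hj => (hw j hj).1)
            (fun j hj => (hw j hj).2),
          nordFun_eq_sum (A := max N M) (B := max N M) ε
            (fun j hj => by rw [map_add, (hv j hj).1, (hw j hj).1, add_zero])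
            (fun j hj => by rw [map_add, (hv j hj).2, (hw j hj).2, add_zero])]
        simp only [map_add, Finset.sum_add_distrib, smul_add]
        abel
      map_smul' := fun z v => by
        obtain ⟨N, hN⟩ := exists_bounds s t k v
        rw [nordFun_eq_sum (A := N) (B := N) ε (fun j hj => (hN j hj).1)
            (fun j hj => (hN j hj).2),
          nordFun_eq_sum (A := N) (B := N) ε
            (fun j hj => by rw [map_smul, (hN j hj).1, smul_zero])
            (fun j hj => by rw [map_smul, (hN j hj).2, smul_zero])]
        simp only [map_smul, ← Finset.smul_sum, smul_add, RingHom.id_apply]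
        rw [smul_comm ε z] }
  property := fun v => by
    obtain ⟨A, hA⟩ := t.2 v
    obtain ⟨B, hB⟩ := exists_bound_comp s t v
    refine ⟨max A (B + 1), fun k hk => ?_⟩
    change nordFun ε s.1 t.1 k v = 0
    have h1 : ∀ j : ℕ, t.1 (k + j) v = 0 := fun j =>
      hA _ (by have := le_trans (le_max_left _ _) hk; omega)
    have h2 : ∀ j : ℕ, t.1 (k - 1 - j) (s.1 j v) = 0 := fun j =>
      hB j _ (by have := le_trans (le_max_right _ _) hk; omega)
    simp [nordFun, h1, h2]

theorem nord_apply (ε : ℂ) (s t : fields n) (k : ℤ) (v : Fock n) :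
    (nord ε s t).1 k v = nordFun ε s.1 t.1 k v := rfl

theorem nord_eq_sum (ε : ℂ) {s t : fields n} {k : ℤ} {v : Fock n} {A B : ℕ}
    (hA : ∀ j : ℕ, A ≤ j → t.1 (k + j) v = 0) (hB : ∀ j : ℕ, B ≤ j → s.1 j v = 0) :
    (nord ε s t).1 k v = (∑ j ∈ Finset.range A, s.1 (-1 - j) (t.1 (k + j) v)) +
      ε • ∑ j ∈ Finset.range B, t.1 (k - 1 - j) (s.1 j v) :=
  nordFun_eq_sum ε hA hB

theorem nord_add_right (ε : ℂ) (s t u : fields n) :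
    nord ε s (t + u) = nord ε s t + nord ε s u := by
  refine Subtype.ext <| funext fun k => LinearMap.ext fun v => ?_
  obtain ⟨N, hN⟩ := exists_bounds s t k v
  obtain ⟨M, hM⟩ := exists_bounds s u k v
  have hv : ∀ j : ℕ, max N M ≤ j → t.1 (k + j) v = 0 ∧ s.1 j v = 0 :=
    fun j hj => hN j (le_trans (le_max_left _ _) hj)
  have hw : ∀ j : ℕ, max N M ≤ j → u.1 (k + j) v = 0 ∧ s.1 j v = 0 :=
    fun j hj => hM j (le_trans (le_max_right _ _) hj)
  change (nord ε s (t + u)).1 k v = (nord ε s t).1 k v + (nord ε s u).1 k v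
  rw [nord_eq_sum (A := max N M) (B := max N M) ε (fun j hj => (hv j hj).1)
      (fun j hj => (hv j hj).2),
    nord_eq_sum (A := max N M) (B := max N M) ε (fun j hj => (hw j hj).1)
      (fun j hj => (hw j hj).2),
    nord_eq_sum (A := max N M) (B := max N M) ε
      (fun j hj => by
        change t.1 (k + j) v + u.1 (k + j) v = 0
        rw [(hv j hj).1, (hw j hj).1, add_zero])
      (fun j hj => (hv j hj).2)]
  simp only [Submodule.coe_add, Pi.add_apply, LinearMap.add_apply, map_add,
    Finset.sum_add_distrib, smul_add]
  abel

theorem nord_smul_right (ε z : ℂ) (s t : fields n) : nord ε s (z • t) = z • nord ε s t := by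
  refine Subtype.ext <| funext fun k => LinearMap.ext fun v => ?_
  obtain ⟨N, hN⟩ := exists_bounds s t k v
  change (nord ε s (z • t)).1 k v = z • (nord ε s t).1 k v
  rw [nord_eq_sum (A := N) (B := N) ε (fun j hj => (hN j hj).1) (fun j hj => (hN j hj).2),
    nord_eq_sum (A := N) (B := N) ε
      (fun j hj => by
        change z • t.1 (k + j) v = 0
        rw [(hN j hj).1, smul_zero]) (fun j hj => (hN j hj).2)]
  simp only [Submodule.coe_smul, Pi.smul_apply, LinearMap.smul_apply, map_smul,
    ← Finset.smul_sum, smul_add]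
  rw [smul_comm ε z]

theorem nord_smul_left (ε z : ℂ) (s t : fields n) : nord ε (z • s) t = z • nord ε s t := by
  refine Subtype.ext <| funext fun k => LinearMap.ext fun v => ?_
  obtain ⟨N, hN⟩ := exists_bounds s t k v
  change (nord ε (z • s) t).1 k v = z • (nord ε s t).1 k v
  rw [nord_eq_sum (A := N) (B := N) ε (fun j hj => (hN j hj).1) (fun j hj => (hN j hj).2),
    nord_eq_sum (A := N) (B := N) ε (fun j hj => (hN j hj).1)
      (fun j hj => by
        change z • s.1 j v = 0
        rw [(hN j hj).2, smul_zero])]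
  simp only [Submodule.coe_smul, Pi.smul_apply, LinearMap.smul_apply, map_smul,
    ← Finset.smul_sum, smul_add]
  rw [smul_comm ε z]

/-- The identity field. -/
def idField (n : ℕ) : fields n :=
  ⟨fun k => if k = -1 then 1 else 0, fun v => ⟨0, fun k hk => by
    have : k ≠ -1 := by omega
    simp [this]⟩⟩

theorem idField_apply (k : ℤ) (v : Fock n) : (idField n).1 k v = if k = -1 then v else 0 := by
  by_cases h : k = -1 <;> simp [idField, h]

theorem nord_one_idField (s : fields n) : nord 1 s (idField n) = s := by
  refine Subtype.ext <| funext fun k => LinearMap.ext fun v => ?_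
  rw [nord_apply, nordFun]
  simp only [idField_apply, apply_ite, map_zero, one_smul]
  -- The mode `s_k` occurs in the creation sum when `k < 0` and in the annihilation sum otherwise.
  rcases lt_or_ge k 0 with h | h
  · rw [finsum_eq_single _ (-1 - k).toNat fun j hj => if_neg (by omega), if_pos (by omega),
      finsum_eq_zero_of_forall_eq_zero fun j => if_neg (by omega), add_zero,
      show -1 - ((-1 - k).toNat : ℤ) = k by omega]
  · rw [finsum_eq_zero_of_forall_eq_zero fun j => if_neg (by omega),
      finsum_eq_single _ k.toNat fun j hj => if_neg (by omega), if_pos (by omega), zero_add,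
      Int.toNat_of_nonneg h]

theorem nord_idField (t : fields n) (ε : ℂ) : nord ε (idField n) t = t := by
  refine Subtype.ext <| funext fun k => LinearMap.ext fun v => ?_
  rw [nord_apply, nordFun]
  rw [finsum_eq_single _ 0 fun j hj => by
      rw [idField_apply, if_neg (by omega)],
    finsum_eq_zero_of_forall_eq_zero fun j => by
      rw [idField_apply, if_neg (by omega), map_zero]]
  simp [idField_apply]

theorem nord_eq_zero_of_annihilated (ε : ℂ) {s t : fields n} {v : Fock n}
    (hs : ∀ j : ℕ, s.1 j v = 0) (ht : ∀ j : ℕ, t.1 j v = 0) (k : ℕ) :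
    (nord ε s t).1 k v = 0 := by
  rw [nord_eq_sum (A := 0) (B := 0) ε (fun j _ => by exact_mod_cast ht (k + j))
    (fun j _ => hs j)]
  simp

theorem nord_neg_one_of_annihilated (ε : ℂ) {s t : fields n} {v : Fock n}
    (hs : ∀ j : ℕ, s.1 j v = 0) (ht : ∀ j : ℕ, t.1 j v = 0) :
    (nord ε s t).1 (-1) v = s.1 (-1) (t.1 (-1) v) := by
  rw [nord_eq_sum (A := 1) (B := 0) ε (fun j hj => by
      have := ht (j - 1)
      rwa [Nat.cast_sub hj, Nat.cast_one, sub_eq_neg_add] at this) (fun j _ => hs j)]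
  simp

/-- Exchange of the first two factors of a nested normally ordered product. -/
theorem nord_nord_comm {η : ℂ} (hη : η * η = 1) (εs εt : ℂ) (s t u : fields n)
    (h : ∀ i j v, s.1 i (t.1 j v) = η • t.1 j (s.1 i v)) :
    nord (η * εs) s (nord εt t u) = η • nord (η * εt) t (nord εs s u) := by
  refine Subtype.ext <| funext fun k => LinearMap.ext fun v => ?_
  change (nord (η * εs) s (nord εt t u)).1 k v = η • (nord (η * εt) t (nord εs s u)).1 k v
  obtain ⟨N1, h1⟩ := exists_bounds s (nord εt t u) k v
  obtain ⟨N2, h2⟩ := exists_bounds t (nord εs s u) k v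
  obtain ⟨N3, h3⟩ := exists_bound_comp s u v
  obtain ⟨N4, h4⟩ := exists_bound_comp t u v
  obtain ⟨N5, h5⟩ := exists_nat_bound u k v
  -- One cutoff for the inner and outer sums makes all double sums run over the same square, where
  -- the order of summation can be exchanged.
  obtain ⟨N, hN1, hN2, hN3, hN4, hN5⟩ : ∃ N : ℕ, N1 ≤ N ∧ N2 ≤ N ∧ N3 ≤ k - 1 + N ∧
      N4 ≤ k - 1 + N ∧ N5 ≤ N :=
    ⟨N1 + N2 + N5 + (N3 - k + 1).toNat + (N4 - k + 1).toNat, by omega, by omega, by omega,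
      by omega, by omega⟩
  have hs : ∀ j : ℕ, N ≤ j → s.1 j v = 0 := fun j hj => (h1 j (by omega)).2
  have ht : ∀ j : ℕ, N ≤ j → t.1 j v = 0 := fun j hj => (h2 j (by omega)).2
  have e1 : ∀ j : ℕ, (nord εt t u).1 (k + j) v =
      (∑ i ∈ Finset.range N, t.1 (-1 - i) (u.1 (k + j + i) v)) +
      εt • ∑ i ∈ Finset.range N, u.1 (k + j - 1 - i) (t.1 i v) := fun j =>
    nord_eq_sum εt (fun i hi => by
      have := h5 (j + i) (by omega)
      rwa [Nat.cast_add, ← add_assoc] at this) ht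
  have e2 : ∀ j : ℕ, (nord εs s u).1 (k + j) v =
      (∑ i ∈ Finset.range N, s.1 (-1 - i) (u.1 (k + i + j) v)) +
      εs • ∑ i ∈ Finset.range N, u.1 (k - 1 - i + j) (s.1 i v) := fun j => by
    rw [nord_eq_sum (A := N) εs (fun i hi => by
      have := h5 (j + i) (by omega)
      rwa [Nat.cast_add, ← add_assoc] at this) hs]
    simp only [add_right_comm k, show ∀ i : ℕ, k + j - 1 - i = k - 1 - i + j from fun i => by ring]
  have e3 : ∀ j : ℕ, (nord εt t u).1 (k - 1 - j) (s.1 j v) =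
      (∑ i ∈ Finset.range N, t.1 (-1 - i) (u.1 (k - 1 - j + i) (s.1 j v))) +
      εt • ∑ i ∈ Finset.range N, u.1 (k - 1 - j - 1 - i) (t.1 i (s.1 j v)) := fun j =>
    nord_eq_sum εt (fun i hi => by
      rw [sub_add_eq_add_sub]
      exact h3 j _ (by omega)) (fun i hi => by
        have := h j i v
        rw [ht i hi, map_zero] at this
        have h' := congrArg (fun x => η • x) this
        simpa [smul_smul, hη] using h'.symm)
  have e4 : ∀ j : ℕ, (nord εs s u).1 (k - 1 - j) (t.1 j v) =
      (∑ i ∈ Finset.range N, s.1 (-1 - i) (u.1 (k + i - 1 - j) (t.1 j v))) +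
      εs • ∑ i ∈ Finset.range N, u.1 (k - 1 - i - 1 - j) (s.1 i (t.1 j v)) := fun j => by
    rw [nord_eq_sum (A := N) εs (fun i hi => by
      rw [sub_add_eq_add_sub]
      exact h4 j _ (by omega)) (fun i hi => by rw [h, hs i hi, map_zero, smul_zero])]
    simp only [show ∀ i : ℕ, k - 1 - j + i = k + i - 1 - j from fun i => by ring,
      show ∀ i : ℕ, k - 1 - j - 1 - i = k - 1 - i - 1 - j from fun i => by ring]
  rw [nord_eq_sum (A := N) (B := N) _ (fun j hj => (h1 j (by omega)).1) hs,
    nord_eq_sum (A := N) (B := N) _ (fun j hj => (h2 j (by omega)).1) ht]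
  simp only [e1, e2, e3, e4, map_add, map_sum, map_smul, smul_add, Finset.sum_add_distrib, h,
    Finset.smul_sum, smul_smul]
  -- Both sides consist of four double sums, according to whether `s` and `t` stand to the left or
  -- to the right of `u`; they agree after transposition.
  have c1 := Finset.sum_comm (s := Finset.range N) (t := Finset.range N)
    (f := fun i j : ℕ => η • t.1 (-1 - j) (s.1 (-1 - i) (u.1 (k + i + j) v)))
  have c2 := Finset.sum_comm (s := Finset.range N) (t := Finset.range N)
    (f := fun i j : ℕ => εt • s.1 (-1 - i) (u.1 (k + i - 1 - j) (t.1 j v)))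
  have c3 := Finset.sum_comm (s := Finset.range N) (t := Finset.range N)
    (f := fun i j : ℕ => (η * εs) • t.1 (-1 - j) (u.1 (k - 1 - i + j) (s.1 i v)))
  have c4 := Finset.sum_comm (s := Finset.range N) (t := Finset.range N)
    (f := fun i j : ℕ => (η * εs * εt) • u.1 (k - 1 - i - 1 - j) (t.1 j (s.1 i v)))
  rw [c1, c2, c3, c4]
  have a1 : η * (η * εt) = εt := by rw [← mul_assoc, hη, one_mul]
  have a2 : η * (η * εt * (εs * η)) = η * εs * εt := by linear_combination (η * εs * εt) * hη
  simp only [a1, a2]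
  exact add_add_add_comm _ _ _ _

/-- The field `s` with its modes renumbered. -/
def shift (m : ℤ) (s : fields n) : fields n :=
  ⟨fun k => s.1 (k + m), fun v => by
    obtain ⟨N, hN⟩ := s.2 v
    exact ⟨N - m, fun k hk => hN _ (by omega)⟩⟩

theorem shift_apply (m : ℤ) (s : fields n) (k : ℤ) : (shift m s).1 k = s.1 (k + m) := rfl

theorem shift_shift (l m : ℤ) (s : fields n) : shift l (shift m s) = shift (l + m) s :=
  Subtype.ext <| funext fun k => by simp only [shift_apply, add_assoc]

theorem shift_zero (s : fields n) : shift 0 s = s :=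
  Subtype.ext <| funext fun k => by simp only [shift_apply, add_zero]

/-- The two sides differ by reindexing each sum by one step, so only the terms with `j = 0` are left
over, and they form the (anti)commutator with `s_0`. -/
theorem nord_shift_one (ε : ℂ) (s t : fields n) (p : ℤ) (v : Fock n) :
    (nord ε (shift 1 s) t).1 p v = (nord ε s (shift 1 t)).1 p v +
      (s.1 0 (t.1 p v) - ε • t.1 p (s.1 0 v)) := by
  obtain ⟨N, hN⟩ := exists_bounds s t p v
  rw [nord_eq_sum (A := N + 1) (B := N) ε (fun j hj => (hN j (by omega)).1)
      (fun j hj => by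
        have := (hN (j + 1) (by omega)).2
        rwa [Nat.cast_add, Nat.cast_one] at this),
    nord_eq_sum (A := N) (B := N + 1) ε (fun j hj => by
        have := (hN (j + 1) (by omega)).1
        rwa [Nat.cast_add, Nat.cast_one, ← add_assoc] at this)
      (fun j hj => (hN j (by omega)).2)]
  have e1 : ∀ j : ℕ, (-1 - ((j + 1 : ℕ) : ℤ) + 1) = -1 - j := fun j => by push_cast; ring
  have e2 : ∀ j : ℕ, p + ((j + 1 : ℕ) : ℤ) = p + j + 1 := fun j => by push_cast; ring
  have e3 : ∀ j : ℕ, p - 1 - ((j + 1 : ℕ) : ℤ) + 1 = p - 1 - j := fun j => by push_cast; ring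
  have e4 : ∀ j : ℕ, ((j + 1 : ℕ) : ℤ) = (j : ℤ) + 1 := fun j => by push_cast; ring
  simp only [Finset.sum_range_succ', shift_apply, e1, e2, e3, smul_add]
  simp only [e4, Nat.cast_zero, sub_zero, add_zero, sub_add_cancel, neg_add_cancel]
  abel

/-- Each unit of shift costs one (anti)commutator by `nord_shift_one`, which is `c` precisely when
`p = d + 1`; summing over `m` units, in either direction, gives `m * c`. -/
theorem nord_shift_neg {ε c : ℂ} {s t : fields n} {d : ℤ}
    (h : ∀ i j v, s.1 i (t.1 j v) = ε • t.1 j (s.1 i v) + (if i + j = d then c else 0) • v)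
    (m p : ℤ) (v : Fock n) :
    (nord ε (shift m s) (shift (-m) t)).1 p v = (nord ε s t).1 p v +
      (if p = d + 1 then m * c else 0) • v := by
  have step : ∀ m : ℤ, (nord ε (shift (m + 1) s) (shift (-(m + 1)) t)).1 p v =
      (nord ε (shift m s) (shift (-m) t)).1 p v + (if p = d + 1 then c else 0) • v := by
    intro m
    have := nord_shift_one ε (shift m s) (shift (-(m + 1)) t) p v
    rw [shift_shift, shift_shift, add_comm 1 m, show 1 + -(m + 1) = -m by ring] at this
    rw [this, shift_apply, shift_apply, h]
    have e : (0 + m + (p + -(m + 1)) = d) ↔ p = d + 1 := by omega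
    simp only [e]
    abel
  induction m using Int.induction_on with
  | zero => simp [shift_zero]
  | succ m ih =>
    rw [step, ih]
    split_ifs
    · push_cast; module
    · module
  | pred m ih =>
    have := step (-m - 1)
    rw [sub_add_cancel, ih] at this
    rw [← sub_eq_iff_eq_add] at this
    rw [← this]
    split_ifs
    · push_cast; module
    · module

/-- Moving a shift of the modes from one factor of a normally ordered product to the other. -/
theorem nord_shift {ε c : ℂ} {s t : fields n}
    (h : ∀ i j v, s.1 i (t.1 j v) = ε • t.1 j (s.1 i v) + (if i + j = -1 then c else 0) • v)
    (m p : ℤ) (v : Fock n) :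
    (nord ε (shift m s) t).1 p v = (nord ε s (shift m t)).1 p v +
      (if p + m = 0 then m * c else 0) • v := by
  have := nord_shift_neg (s := s) (t := shift m t) (ε := ε) (c := c) (d := -1 - m)
    (fun i j v => by
      rw [shift_apply, h]
      have e : (i + (j + m) = -1) ↔ i + j = -1 - m := by omega
      simp only [e]) m p v
  rw [shift_shift, neg_add_cancel, shift_zero] at this
  rw [this]
  have e : (p = -1 - m + 1) ↔ p + m = 0 := by omega
  simp only [e]

/-- A contraction with a mode `a_p` is a multiple of the shifted identity field, so this evaluates
the contraction terms in the Leibniz rule. The identity commutes with everything, hence no central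
term. -/
theorem nord_shift_idField (s : fields n) (m p : ℤ) (v : Fock n) :
    (nord 1 s (shift m (idField n))).1 p v = s.1 (p + m) v := by
  have := nord_shift (ε := 1) (c := 0) (s := s) (t := idField n) (fun i j v => by
    rw [idField_apply, idField_apply, apply_ite (s.1 i)]
    simp) m p v
  simp only [mul_zero, ite_self, zero_smul, add_zero] at this
  rw [← this, nord_one_idField, shift_apply]

theorem shift_idField_nord (t : fields n) (m p : ℤ) (v : Fock n) :
    (nord 1 (shift m (idField n)) t).1 p v = t.1 (p + m) v := by
  have := nord_shift (ε := 1) (c := 0) (s := idField n) (t := t) (fun i j v => by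
    rw [idField_apply, idField_apply, apply_ite (t.1 j)]
    simp) m p v
  simp only [mul_zero, ite_self, zero_smul, add_zero] at this
  rw [this, nord_idField, shift_apply]

/-- An operator that (anti)commutes with two fields up to given fields acts on their normally
ordered product by the Leibniz rule. -/
theorem map_nord (O : Fock n →ₗ[ℂ] Fock n) {α β ε : ℂ} (hα : α * α = 1)
    {s t s' t' : fields n}
    (hs : ∀ k v, O (s.1 k v) = α • s.1 k (O v) + s'.1 k v)
    (ht : ∀ k v, O (t.1 k v) = β • t.1 k (O v) + t'.1 k v) (k : ℤ) (v : Fock n) :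
    O ((nord ε s t).1 k v) = (α * β) • (nord ε s t).1 k (O v) +
      α • (nord (α * ε) s t').1 k v + (nord (β * ε) s' t).1 k v := by
  obtain ⟨N1, h1⟩ := exists_bounds s t k v
  obtain ⟨N2, h2⟩ := exists_bounds s t k (O v)
  obtain ⟨N3, h3⟩ := exists_bounds s' t' k v
  obtain ⟨N, hN1, hN2, hN3⟩ : ∃ N : ℕ, N1 ≤ N ∧ N2 ≤ N ∧ N3 ≤ N :=
    ⟨N1 + N2 + N3, by omega, by omega, by omega⟩
  rw [nord_eq_sum (A := N) (B := N) _ (fun j hj => (h1 j (by omega)).1)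
      (fun j hj => (h1 j (by omega)).2),
    nord_eq_sum (A := N) (B := N) _ (fun j hj => (h2 j (by omega)).1)
      (fun j hj => (h2 j (by omega)).2),
    nord_eq_sum (A := N) (B := N) _ (fun j hj => (h3 j (by omega)).1)
      (fun j hj => (h1 j (by omega)).2),
    nord_eq_sum (A := N) (B := N) _ (fun j hj => (h1 j (by omega)).1)
      (fun j hj => (h3 j (by omega)).2)]
  simp only [map_add, map_sum, map_smul, hs, ht, smul_add, Finset.sum_add_distrib,
    Finset.smul_sum, smul_smul]
  have a : α * (α * ε) = ε := by rw [← mul_assoc, hα, one_mul]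
  simp only [a, mul_comm ε, mul_comm β α]
  rw [mul_right_comm α β ε]
  abel

theorem map_nord_of_comm (O : Fock n →ₗ[ℂ] Fock n) {α β ε : ℂ} (hα : α * α = 1)
    {s t : fields n} (hs : ∀ k v, O (s.1 k v) = α • s.1 k (O v))
    (ht : ∀ k v, O (t.1 k v) = β • t.1 k (O v)) (k : ℤ) (v : Fock n) :
    O ((nord ε s t).1 k v) = (α * β) • (nord ε s t).1 k (O v) := by
  have z1 : ∀ (ε : ℂ) (s : fields n), nord ε s 0 = 0 := fun ε s => by
    simpa using nord_smul_right ε 0 s 0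
  have z2 : ∀ (ε : ℂ) (s : fields n), nord ε 0 s = 0 := fun ε s => by
    simpa using nord_smul_left ε 0 0 s
  have := map_nord O (ε := ε) (s' := 0) (t' := 0) hα (by simpa using hs) (by simpa using ht) k v
  simpa [z1, z2] using this

/-! ### The state-field correspondence -/

/-- The field of a bosonic generator. -/
def evenField (a : EvenGen n) : fields n := ⟨evenMode a, evenMode_mem_fields a⟩

/-- The field of a fermionic generator. -/
def oddField (a : OddGen n) : fields n := ⟨oddMode a, oddMode_mem_fields a⟩

theorem evenField_apply (a : EvenGen n) (k : ℤ) : (evenField a).1 k = evenMode a k := rfl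

theorem oddField_apply (a : OddGen n) (k : ℤ) : (oddField a).1 k = oddMode a k := rfl

/-- The field of a letter. -/
def letterField (s : Letter n) : fields n :=
  ⟨letterMode s, fun v => by
    rcases s with p | p
    · obtain ⟨N, hN⟩ := evenMode_mem_fields (ofLex p).1 v
      exact ⟨N + (ofLex p).2, fun k hk => by simp [letterMode, hN (k - (ofLex p).2) (by omega)]⟩
    · obtain ⟨N, hN⟩ := oddMode_mem_fields (ofLex p).1 v
      exact ⟨N + (ofLex p).2, fun k hk => by simp [letterMode, hN (k - (ofLex p).2) (by omega)]⟩⟩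

theorem letterField_inl (a : EvenGen n) : letterField (.inl (toLex (a, 0))) = evenField a :=
  Subtype.ext <| funext fun k => by simp [letterField, letterMode, evenField]

theorem letterField_inr (a : OddGen n) : letterField (.inr (toLex (a, 0))) = oddField a :=
  Subtype.ext <| funext fun k => by simp [letterField, letterMode, oddField]

/-- The field of the nested normally ordered product of the letters of a word. -/
def wordField : List (Letter n) → fields n
  | [] => idField n
  | s :: l => nord (letterSign s l) (letterField s) (wordField l)

theorem wordMode_eq (l : List (Letter n)) (k : ℤ) (v : Fock n) :
    wordMode l k v = (wordField l).1 k v := by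
  induction l generalizing k v with
  | nil => rw [wordField, idField_apply, wordMode]
  | cons s l ih =>
    rw [wordField, nord_apply, nordFun, wordMode]
    simp only [ih]
    rfl

/-- The field of a state. -/
def stateField : Fock n →ₗ[ℂ] fields n :=
  Finsupp.linearCombination ℂ fun o : Occ n => wordField o.word

theorem mode_eq (u : Fock n) (k : ℤ) (v : Fock n) : mode u k v = (stateField u).1 k v := by
  induction u using Finsupp.induction_linear with
  | zero => simp [mode]
  | add f g hf hg =>
    have : mode (f + g) k v = mode f k v + mode g k v :=
      Finsupp.sum_add_index' (by simp) (fun o a b => by rw [add_smul])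
    rw [this, hf, hg, map_add]
    rfl
  | single o z => simp [mode, stateField, wordMode_eq]

theorem nop_eq (u v : Fock n) : nop u v = (stateField u).1 (-1) v := by
  rw [nop, opProd, mode_eq]
  rfl

theorem stateField_ket (o : Occ n) : stateField (ket o) = wordField o.word := by
  simp [stateField, ket]

/-- The word of a basis vector is obtained by sorting, so a list that is already in order can be
read off as the word of an explicit state. -/
theorem Occ.word_of_sort (o : Occ n) {l : List (EvenMode n)} {l' : List (OddMode n)}
    (hl : (l : Multiset (EvenMode n)) = Finsupp.toMultiset o.1) (hl' : o.2 = l'.toFinset)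
    (sl : l.Pairwise (· ≤ ·)) (sl' : l'.Pairwise (· < ·)) :
    o.word = l.map Sum.inl ++ l'.map Sum.inr := by
  rw [Occ.word]
  congr 2
  · rw [← hl, Multiset.coe_sort]
    exact List.mergeSort_eq_self _ (by simpa using sl)
  · rw [hl']
    exact (List.toFinset_sort (· ≤ ·) (sl'.imp ne_of_lt)).2 (sl'.imp le_of_lt)

theorem evenMode_neg_one_vac (a : EvenGen n) :
    evenMode a (-1) vac = ket (Finsupp.single (toLex (a, 0)) 1, ∅) :=
  (evenCre_ket (toLex (a, 0)) (0, ∅)).trans (by simp)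

theorem oddMode_neg_one_vac (a : OddGen n) :
    oddMode a (-1) vac = ket (0, {toLex (a, 0)}) :=
  (oddCre_ket (toLex (a, 0)) (0, ∅)).trans (by simp [oddSign])

theorem letterSign_nil (s : Letter n) : letterSign s [] = 1 := by
  simp [letterSign]

theorem letterSign_odd_one (a b : OddMode n) : letterSign (.inr a) [.inr b] = -1 := by
  simp [letterSign, List.filter]

theorem letterSign_odd_two (a b c : OddMode n) : letterSign (.inr a) [.inr b, .inr c] = 1 := by
  simp [letterSign, List.filter]

theorem stateField_evenMode (a : EvenGen n) :
    stateField (evenMode a (-1) vac) = evenField a := by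
  rw [evenMode_neg_one_vac, stateField_ket, Occ.word_of_sort (l := [toLex (a, 0)]) (l' := []) _ (by simp)
    (by simp) (by simp) (by simp)]
  simp [wordField, letterSign, letterField_inl, nord_one_idField]

theorem stateField_oddMode (a : OddGen n) :
    stateField (oddMode a (-1) vac) = oddField a := by
  rw [oddMode_neg_one_vac, stateField_ket,
    Occ.word_of_sort (l := []) (l' := [toLex (a, 0)]) _ (by simp)
    (by simp) (by simp) (by simp)]
  simp [wordField, letterSign, letterField_inr, nord_one_idField]

theorem nop_even (a : EvenGen n) (v : Fock n) : nop (evenMode a (-1) vac) v = evenMode a (-1) v := by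
  rw [nop_eq, stateField_evenMode, evenField_apply]

theorem nop_odd (a : OddGen n) (v : Fock n) : nop (oddMode a (-1) vac) v = oddMode a (-1) v := by
  rw [nop_eq, stateField_oddMode, oddField_apply]

theorem evenGen_X_lt_Y (i j : Fin n) : EvenGen.X i < EvenGen.Y j := by
  change toLex (0, i.val) < toLex (1, j.val)
  simp [Prod.Lex.toLex_lt_toLex]

theorem oddGen_psi_lt_chi (i j : Fin n) : OddGen.psi i < OddGen.chi j := by
  change toLex (0, i.val) < toLex (1, j.val)
  simp [Prod.Lex.toLex_lt_toLex]

theorem oddGen_psi_lt_c (i : Fin n) (j : Fin (n - 1)) : OddGen.psi i < OddGen.c j := by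
  change toLex (0, i.val) < toLex (3, j.val)
  simp [Prod.Lex.toLex_lt_toLex]

theorem oddGen_chi_lt_c (i : Fin n) (j : Fin (n - 1)) : OddGen.chi i < OddGen.c j := by
  change toLex (1, i.val) < toLex (3, j.val)
  simp [Prod.Lex.toLex_lt_toLex]

theorem mode_lt_mode {α : Type*} [LinearOrder α] {a b : α} (h : a < b) (k l : ℕ) :
    (toLex (a, k) : α ×ₗ ℕ) < toLex (b, l) := by
  simp [Prod.Lex.toLex_lt_toLex, h]

/-- The states `X_i Y_i`, as basis vectors. -/
theorem evenMode_XY (i : Fin n) : evenMode (.X i) (-1) (evenMode (.Y i) (-1) vac) =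
    ket (Finsupp.single (toLex (.Y i, 0)) 1 + Finsupp.single (toLex (.X i, 0)) 1, ∅) := by
  rw [evenMode_neg_one_vac]
  exact evenCre_ket _ _

theorem oddMode_psi_chi (i : Fin n) : oddMode (.psi i) (-1) (oddMode (.chi i) (-1) vac) =
    ket (0, {toLex (.psi i, 0), toLex (.chi i, 0)}) := by
  rw [oddMode_neg_one_vac]
  have h := mode_lt_mode (oddGen_psi_lt_chi i i) 0 0
  refine (oddCre_ket _ _).trans ?_
  simp [oddSign, h.ne, h.not_gt, Finset.filter_singleton]

theorem stateField_XY (i : Fin n) : stateField (nop (opX i) (opY i)) =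
    nord 1 (evenField (.X i)) (evenField (.Y i)) := by
  have h := mode_lt_mode (evenGen_X_lt_Y i i) 0 0
  rw [opX, opY, nop_even, evenMode_XY, stateField_ket,
    Occ.word_of_sort (l := [toLex (.X i, 0), toLex (.Y i, 0)]) (l' := []) _
    (by simp [← Multiset.cons_coe, add_comm]) (by simp) (by simpa using h.le) (by simp)]
  simp [wordField, letterSign, letterField_inl, nord_one_idField]

theorem stateField_psi_chi (i : Fin n) : stateField (nop (opPsi i) (opChi i)) =
    nord (-1) (oddField (.psi i)) (oddField (.chi i)) := by
  have h := mode_lt_mode (oddGen_psi_lt_chi i i) 0 0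
  rw [opPsi, opChi, nop_odd, oddMode_psi_chi, stateField_ket,
    Occ.word_of_sort (l := []) (l' := [toLex (.psi i, 0), toLex (.chi i, 0)]) _
    (by simp) (by simp) (by simp) (by simpa using h)]
  simp only [List.map_nil, List.map_cons, List.nil_append, wordField, letterSign_odd_one,
    letterSign_nil, letterField_inr, nord_one_idField]

theorem stateField_even_odd (a : EvenGen n) (b : OddGen n) :
    stateField (nop (evenMode a (-1) vac) (oddMode b (-1) vac)) =
      nord 1 (evenField a) (oddField b) := by
  have : evenMode a (-1) (oddMode b (-1) vac) =
      ket (Finsupp.single (toLex (a, 0)) 1, {toLex (b, 0)}) := by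
    rw [oddMode_neg_one_vac]
    exact (evenCre_ket (toLex (a, 0)) (0, {toLex (b, 0)})).trans (by simp)
  rw [nop_even, this, stateField_ket,
    Occ.word_of_sort (l := [toLex (a, 0)]) (l' := [toLex (b, 0)]) _
    (by simp) (by simp) (by simp) (by simp)]
  simp [wordField, letterSign, letterField_inr, letterField_inl, nord_one_idField]

theorem stateField_c_XY (a : Fin (n - 1)) (i : Fin n) :
    stateField (nop (opC a) (nop (opX i) (opY i))) =
      nord 1 (oddField (.c a)) (nord 1 (evenField (.X i)) (evenField (.Y i))) := by
  have h := mode_lt_mode (evenGen_X_lt_Y i i) 0 0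
  have e : oddMode (.c a) (-1) (evenMode (.X i) (-1) (evenMode (.Y i) (-1) vac)) =
      ket (Finsupp.single (toLex (.Y i, 0)) 1 + Finsupp.single (toLex (.X i, 0)) 1,
        {toLex (.c a, 0)}) := by
    rw [evenMode_XY]
    refine (oddCre_ket _ _).trans ?_
    simp [oddSign]
  rw [opC, nop_odd, opX, opY, nop_even, e, stateField_ket,
    Occ.word_of_sort (l := [toLex (.X i, 0), toLex (.Y i, 0)]) (l' := [toLex (.c a, 0)]) _
    (by simp [← Multiset.cons_coe, add_comm]) (by simp) (by simpa using h.le) (by simp)]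
  -- The sorted word places the ghost last; it is carried to the front past `Y` and then past `X`.
  have h1 := nord_nord_comm (η := 1) (by simp) 1 1 (evenField (.Y i)) (oddField (.c a))
    (idField n) (fun p q v => by simp [evenField_apply, oddField_apply, evenMode_oddMode])
  have h2 := nord_nord_comm (η := 1) (by simp) 1 1 (evenField (.X i)) (oddField (.c a))
    (evenField (.Y i)) (fun p q v => by simp [evenField_apply, oddField_apply, evenMode_oddMode])
  simp only [mul_one, one_smul, nord_one_idField] at h1 h2
  simp [wordField, letterSign, letterField_inl, letterField_inr, nord_one_idField, h1, h2]

theorem stateField_c_psi_chi (a : Fin (n - 1)) (i : Fin n) :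
    stateField (nop (opC a) (nop (opPsi i) (opChi i))) =
      nord 1 (oddField (.c a)) (nord (-1) (oddField (.psi i)) (oddField (.chi i))) := by
  have h := mode_lt_mode (oddGen_psi_lt_chi i i) 0 0
  have h' := mode_lt_mode (oddGen_psi_lt_c i a) 0 0
  have h'' := mode_lt_mode (oddGen_chi_lt_c i a) 0 0
  have e : oddMode (.c a) (-1) (oddMode (.psi i) (-1) (oddMode (.chi i) (-1) vac)) =
      ket (0, {toLex (.psi i, 0), toLex (.chi i, 0), toLex (.c a, 0)}) := by
    rw [oddMode_psi_chi]
    refine (oddCre_ket _ _).trans ?_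
    have hS : ({toLex (.c a, 0), toLex (.psi i, 0), toLex (.chi i, 0)} : Finset (OddMode n)) =
        {toLex (.psi i, 0), toLex (.chi i, 0), toLex (.c a, 0)} := by
      rw [Finset.insert_comm, Finset.pair_comm (toLex (OddGen.c a, 0))]
    simp [oddSign, h'.ne', h''.ne', Finset.filter_insert, Finset.filter_singleton, h', h'', hS,
      h.ne]
  rw [opC, nop_odd, opPsi, opChi, nop_odd, e, stateField_ket,
    Occ.word_of_sort (l := [])
      (l' := [toLex (.psi i, 0), toLex (.chi i, 0), toLex (.c a, 0)]) _
    (by simp) (by simp) (by simp) (by simp [h, h', h''])]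
  -- The ghost again comes last in the sorted word. It passes two fermions, and the two signs
  -- cancel.
  have h1 := nord_nord_comm (η := -1) (by simp) 1 1 (oddField (.chi i)) (oddField (.c a))
    (idField n) (fun p q v => by
      simp only [oddField_apply]
      rw [oddMode_oddMode]
      simp [oddPairing])
  have h2 := nord_nord_comm (η := -1) (by simp) (-1) (-1) (oddField (.psi i)) (oddField (.c a))
    (oddField (.chi i)) (fun p q v => by
      simp only [oddField_apply]
      rw [oddMode_oddMode]
      simp [oddPairing])
  simp only [mul_one, mul_neg, neg_neg, nord_one_idField] at h1 h2
  simp only [List.map_nil, List.map_cons, List.nil_append, wordField, letterSign_odd_one,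
    letterSign_odd_two, letterSign_nil, letterField_inr, nord_one_idField, h1]
  rw [nord_smul_right, h2, smul_smul, neg_mul_neg, one_mul, one_smul]

/-! ### Currents -/

theorem even_apply_nord_XY (a : EvenGen n) (i : Fin n) (p k : ℤ) (v : Fock n) :
    evenMode a p ((nord 1 (evenField (.X i)) (evenField (.Y i))).1 k v) =
      (nord 1 (evenField (.X i)) (evenField (.Y i))).1 k (evenMode a p v) +
        evenPairing a (.Y i) • evenMode (.X i) (k + p) v +
        evenPairing a (.X i) • evenMode (.Y i) (k + p) v := by
  -- The commutator with a generating field is the identity field shifted by `p`, the form required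
  -- by `map_nord`.
  have key : ∀ b k v, evenMode a p ((evenField b).1 k v) = (1 : ℂ) • (evenField b).1 k
      (evenMode a p v) + (evenPairing a b • shift p (idField n)).1 k v := fun b k v => by
    change evenMode a p (evenMode b k v) = (1 : ℂ) • evenMode b k (evenMode a p v) +
      evenPairing a b • (idField n).1 (k + p) v
    rw [evenMode_evenMode, idField_apply, add_comm k p, one_smul]
    split_ifs <;> simp
  rw [map_nord (evenMode a p) (by simp) (key _) (key _)]
  have e1 := nord_shift_idField (evenField (.X i)) p k v
  have e2 := shift_idField_nord (evenField (.Y i)) p k v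
  rw [evenField_apply] at e1 e2
  rw [nord_smul_left, nord_smul_right, ← e1, ← e2]
  simp

theorem odd_apply_nord_XY (b : OddGen n) (i : Fin n) (p k : ℤ) (v : Fock n) :
    oddMode b p ((nord 1 (evenField (.X i)) (evenField (.Y i))).1 k v) =
      (nord 1 (evenField (.X i)) (evenField (.Y i))).1 k (oddMode b p v) := by
  have key : ∀ a k v, oddMode b p ((evenField a).1 k v) =
      (1 : ℂ) • (evenField a).1 k (oddMode b p v) := fun a k v => by
    rw [evenField_apply, one_smul, evenMode_oddMode]
  simpa using map_nord_of_comm (oddMode b p) (ε := 1) (by simp) (key (.X i)) (key (.Y i)) k v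

theorem even_apply_nord_psi_chi (a : EvenGen n) (i : Fin n) (p k : ℤ) (v : Fock n) :
    evenMode a p ((nord (-1) (oddField (.psi i)) (oddField (.chi i))).1 k v) =
      (nord (-1) (oddField (.psi i)) (oddField (.chi i))).1 k (evenMode a p v) := by
  have key : ∀ b k v, evenMode a p ((oddField b).1 k v) =
      (1 : ℂ) • (oddField b).1 k (evenMode a p v) := fun b k v => by
    rw [oddField_apply, one_smul, evenMode_oddMode]
  simpa using map_nord_of_comm (evenMode a p) (ε := -1) (by simp) (key (.psi i)) (key (.chi i)) k v

theorem odd_apply_nord_psi_chi (b : OddGen n) (i : Fin n) (p k : ℤ) (v : Fock n) :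
    oddMode b p ((nord (-1) (oddField (.psi i)) (oddField (.chi i))).1 k v) =
      (nord (-1) (oddField (.psi i)) (oddField (.chi i))).1 k (oddMode b p v) -
        oddPairing b (.chi i) • oddMode (.psi i) (k + p) v +
        oddPairing b (.psi i) • oddMode (.chi i) (k + p) v := by
  have key : ∀ a k v, oddMode b p ((oddField a).1 k v) = (-1 : ℂ) • (oddField a).1 k
      (oddMode b p v) + (oddPairing b a • shift p (idField n)).1 k v := fun a k v => by
    change oddMode b p (oddMode a k v) = (-1 : ℂ) • oddMode a k (oddMode b p v) +
      oddPairing b a • (idField n).1 (k + p) v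
    rw [oddMode_oddMode, idField_apply, add_comm k p, neg_one_smul]
    split_ifs <;> simp
  rw [map_nord (oddMode b p) (by simp) (key _) (key _)]
  have e1 := nord_shift_idField (oddField (.psi i)) p k v
  have e2 := shift_idField_nord (oddField (.chi i)) p k v
  rw [oddField_apply] at e1 e2
  rw [nord_smul_left, nord_smul_right, ← e1, ← e2]
  simp [sub_eq_add_neg]

/-- The field of `X i Y i + psi i chi i`. -/
def cur (i : Fin n) : fields n :=
  nord 1 (evenField (.X i)) (evenField (.Y i)) + nord (-1) (oddField (.psi i)) (oddField (.chi i))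

theorem cur_apply (i : Fin n) (k : ℤ) (v : Fock n) : (cur i).1 k v =
    (nord 1 (evenField (.X i)) (evenField (.Y i))).1 k v +
      (nord (-1) (oddField (.psi i)) (oddField (.chi i))).1 k v := rfl

theorem stateField_current (i : Fin n) : stateField (current i) = cur i := by
  rw [current, map_add, stateField_XY, stateField_psi_chi, cur]

/-- The charge of a bosonic generator under the `i`-th current. -/
def evenCharge (i : Fin n) : EvenGen n → ℂ
  | .X j => if i = j then -1 else 0
  | .Y j => if i = j then 1 else 0

/-- The charge of a fermionic generator under the `i`-th current. -/
def oddCharge (i : Fin n) : OddGen n → ℂ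
  | .psi j => if i = j then 1 else 0
  | .chi j => if i = j then -1 else 0
  | _ => 0

theorem cur_evenMode (i : Fin n) (a : EvenGen n) (m p : ℤ) (v : Fock n) :
    (cur i).1 m (evenMode a p v) =
      evenMode a p ((cur i).1 m v) + evenCharge i a • evenMode a (p + m) v := by
  rw [cur_apply, cur_apply, map_add, even_apply_nord_XY, even_apply_nord_psi_chi, add_comm m p]
  cases a with
  | X j =>
    by_cases h : i = j
    · subst h; simp [evenPairing, evenCharge]; abel
    · simp [evenPairing, evenCharge, h, Ne.symm h]
  | Y j =>
    by_cases h : i = j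
    · subst h; simp [evenPairing, evenCharge]; abel
    · simp [evenPairing, evenCharge, h, Ne.symm h]

theorem cur_oddMode (i : Fin n) (b : OddGen n) (m p : ℤ) (v : Fock n) :
    (cur i).1 m (oddMode b p v) =
      oddMode b p ((cur i).1 m v) + oddCharge i b • oddMode b (p + m) v := by
  rw [cur_apply, cur_apply, map_add, odd_apply_nord_XY, odd_apply_nord_psi_chi, add_comm m p]
  cases b with
  | psi j =>
    by_cases h : i = j
    · subst h; simp [oddPairing, oddCharge]; abel
    · simp [oddPairing, oddCharge, h, Ne.symm h]
  | chi j =>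
    by_cases h : i = j
    · subst h; simp [oddPairing, oddCharge]; abel
    · simp [oddPairing, oddCharge, h, Ne.symm h]
  | b j => simp [oddPairing, oddCharge]
  | c j => simp [oddPairing, oddCharge]

/-- A current acts on the product of two fields of opposite charges through a central term. -/
theorem cur_nord_of_neutral (i : Fin n) {ε c q : ℂ} {s t : fields n} (m k : ℤ)
    (hs : ∀ p v, (cur i).1 m (s.1 p v) = s.1 p ((cur i).1 m v) + q • s.1 (p + m) v)
    (ht : ∀ p v, (cur i).1 m (t.1 p v) = t.1 p ((cur i).1 m v) - q • t.1 (p + m) v)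
    (h : ∀ i j v, s.1 i (t.1 j v) = ε • t.1 j (s.1 i v) + (if i + j = -1 then c else 0) • v)
    (v : Fock n) :
    (cur i).1 m ((nord ε s t).1 k v) = (nord ε s t).1 k ((cur i).1 m v) +
      (q * if k + m = 0 then m * c else 0) • v := by
  rw [map_nord ((cur i).1 m) (α := 1) (β := 1) (s' := q • shift m s) (t' := (-q) • shift m t)
    (by simp) (fun p v => by
      rw [hs, one_smul]
      rfl) (fun p v => by
      rw [ht, one_smul, sub_eq_add_neg, ← neg_smul]
      rfl), nord_smul_left, nord_smul_right]
  have e := nord_shift h m k v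
  simp only [one_mul, one_smul, Submodule.coe_smul, Pi.smul_apply, LinearMap.smul_apply]
  rw [e]
  module

/-- The central terms are `m` times the charges of `X_j` and of `psi_j`, which are opposite. This
cancellation is the reason for adding the fermions to the bosonic current. -/
theorem cur_cur (i j : Fin n) (m k : ℤ) (v : Fock n) :
    (cur i).1 m ((cur j).1 k v) = (cur j).1 k ((cur i).1 m v) := by
  have h1 := cur_nord_of_neutral i (ε := 1) (c := 1) (q := evenCharge i (.X j)) (s := evenField (.X j))
    (t := evenField (.Y j)) m k (fun p v => cur_evenMode i _ m p v) (fun p v => by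
      rw [evenField_apply, cur_evenMode]
      by_cases h : i = j <;> simp [evenCharge, h, sub_eq_add_neg, evenField_apply]) (fun p q v => by
      rw [evenField_apply, evenField_apply, evenMode_evenMode, one_smul]
      simp [evenPairing]) v
  have h2 := cur_nord_of_neutral i (ε := -1) (c := 1) (q := oddCharge i (.psi j))
    (s := oddField (.psi j))
    (t := oddField (.chi j)) m k (fun p v => cur_oddMode i _ m p v) (fun p v => by
      rw [oddField_apply, cur_oddMode]
      by_cases h : i = j <;> simp [oddCharge, h, sub_eq_add_neg, oddField_apply]) (fun p q v => by
      rw [oddField_apply, oddField_apply, oddMode_oddMode]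
      simp [oddPairing]) v
  rw [cur_apply j, cur_apply j, map_add, h1, h2]
  by_cases h : i = j
  · simp only [evenCharge, oddCharge, h, if_true]
    module
  · simp [evenCharge, oddCharge, h]

/-! ### The two families of generators -/

/-- The bosons `X i` and `Y i`. -/
def boson (n : ℕ) : Bool → Fin n → EvenGen n
  | true, i => .X i
  | false, i => .Y i

/-- The fermions `chi i` and `psi i`, of the same charge as `X i` and `Y i`. -/
def fermion (n : ℕ) : Bool → Fin n → OddGen n
  | true, i => .chi i
  | false, i => .psi i

/-- The common charge of `X i` and `chi i`, and of `Y i` and `psi i`. -/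
def sideCharge : Bool → ℂ
  | true => -1
  | false => 1

theorem sideCharge_not (σ : Bool) : sideCharge (!σ) = -sideCharge σ := by
  cases σ <;> simp [sideCharge]

theorem evenCharge_boson (σ : Bool) (i j : Fin n) :
    evenCharge i (boson n σ j) = if i = j then sideCharge σ else 0 := by
  cases σ <;> rfl

theorem oddCharge_fermion (σ : Bool) (i j : Fin n) :
    oddCharge i (fermion n σ j) = if i = j then sideCharge σ else 0 := by
  cases σ <;> rfl

/-- The field of `M_i^+ = X i psi i` or `M_i^- = Y i chi i`. -/
def matter (σ : Bool) (i : Fin n) : fields n :=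
  nord 1 (evenField (boson n σ i)) (oddField (fermion n (!σ) i))

theorem stateField_opMplus (i : Fin n) : stateField (opMplus i) = matter true i :=
  stateField_even_odd _ _

theorem stateField_opMminus (i : Fin n) : stateField (opMminus i) = matter false i :=
  stateField_even_odd _ _

/-- The two factors have opposite charges and no contraction with each other, so not even a central
term appears. -/
theorem cur_matter (σ : Bool) (i j : Fin n) (m k : ℤ) (v : Fock n) :
    (cur i).1 m ((matter σ j).1 k v) = (matter σ j).1 k ((cur i).1 m v) := by
  have h1 := cur_nord_of_neutral i (ε := 1) (c := 0) (q := evenCharge i (boson n σ j))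
    (s := evenField (boson n σ j)) (t := oddField (fermion n (!σ) j)) m k
    (fun p v => cur_evenMode i _ m p v) (fun p v => by
      rw [oddField_apply, cur_oddMode, oddCharge_fermion, evenCharge_boson, sideCharge_not]
      by_cases h : i = j <;> simp [h, sub_eq_add_neg, oddField_apply]) (fun p q v => by
      rw [evenField_apply, oddField_apply, evenMode_oddMode]
      simp) v
  simpa [matter] using h1

theorem c_cur (a : Fin (n - 1)) (i : Fin n) (p k : ℤ) (v : Fock n) :
    oddMode (.c a) p ((cur i).1 k v) = (cur i).1 k (oddMode (.c a) p v) := by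
  rw [cur_oddMode]
  simp [oddCharge]

theorem c_matter (a : Fin (n - 1)) (σ : Bool) (i : Fin n) (p k : ℤ) (v : Fock n) :
    oddMode (.c a) p ((matter σ i).1 k v) = -(matter σ i).1 k (oddMode (.c a) p v) := by
  have := map_nord_of_comm (oddMode (.c a) p) (ε := 1) (α := 1) (β := -1) (by simp)
    (s := evenField (boson n σ i)) (t := oddField (fermion n (!σ) i))
    (fun k v => by rw [evenField_apply, evenMode_oddMode, one_smul]) (fun k v => by
      rw [oddField_apply, oddMode_oddMode]
      cases σ <;> simp [fermion, oddPairing]) k v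
  simpa [matter] using this

/-! ### The BRST charge -/

theorem nop_add (u v w : Fock n) : nop u (v + w) = nop u v + nop u w := by
  simp only [nop_eq, map_add]

theorem nop_sub (u v w : Fock n) : nop u (v - w) = nop u v - nop u w := by
  simp only [nop_eq, map_sub]

theorem stateField_c_current (a : Fin (n - 1)) (i : Fin n) :
    stateField (nop (opC a) (current i)) = nord 1 (oddField (.c a)) (cur i) := by
  rw [current, nop_add, map_add, stateField_c_XY, stateField_c_psi_chi, cur, nord_add_right]

theorem Q_eq_sum (v : Fock n) : Q v = ∑ a : Fin (n - 1),
    ((nord 1 (oddField (.c a)) (cur ⟨a.val, by have := a.isLt; omega⟩)).1 0 v -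
      (nord 1 (oddField (.c a)) (cur ⟨a.val + 1, by have := a.isLt; omega⟩)).1 0 v) := by
  rw [Q, mode_eq, brstCurrent]
  rw [map_sum, Submodule.coe_sum, Finset.sum_apply, LinearMap.sum_apply]
  refine Finset.sum_congr rfl fun a _ => ?_
  have e : ∀ x y : Fock n, x - y = x + (-1 : ℂ) • y := fun x y => by
    rw [neg_one_smul, sub_eq_add_neg]
  rw [nop_sub, e, e, map_add, map_smul, stateField_c_current, stateField_c_current]
  rfl

/-- The linear map `Q`. -/
def brst (n : ℕ) : Fock n →ₗ[ℂ] Fock n := (stateField (brstCurrent n)).1 0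

theorem brst_apply (v : Fock n) : brst n v = Q v := (mode_eq _ _ _).symm

/-- Ghost-free states on which all the nonnegative modes of the currents agree. -/
def invariants (n : ℕ) : Submodule ℂ (Fock n) where
  carrier := {v | (∀ (a : Fin (n - 1)) (m : ℕ), oddMode (.c a) m v = 0) ∧
    ∀ (i j : Fin n) (m : ℕ), (cur i).1 m v = (cur j).1 m v}
  zero_mem' := by simp
  add_mem' := fun {v w} hv hw =>
    ⟨fun a m => by rw [map_add, hv.1, hw.1, add_zero],
      fun i j m => by rw [map_add, map_add, hv.2 i j, hw.2 i j]⟩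
  smul_mem' := fun z v hv =>
    ⟨fun a m => by rw [map_smul, hv.1, smul_zero],
      fun i j m => by rw [map_smul, map_smul, hv.2 i j]⟩

theorem cur_mem_invariants (i : Fin n) (k : ℤ) {v : Fock n} (hv : v ∈ invariants n) :
    (cur i).1 k v ∈ invariants n :=
  ⟨fun a m => by rw [c_cur, hv.1, map_zero],
    fun j l m => by rw [cur_cur, cur_cur l, hv.2 j l]⟩

theorem matter_mem_invariants (σ : Bool) (i : Fin n) (k : ℤ) {v : Fock n}
    (hv : v ∈ invariants n) : (matter σ i).1 k v ∈ invariants n :=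
  ⟨fun a m => by rw [c_matter, hv.1, map_zero, neg_zero],
    fun j l m => by rw [cur_matter, cur_matter, hv.2 j l]⟩

/-- The creation sum drops out because the difference of currents annihilates `b_a v`. In the other
sum only `c_0` sees `b_a`, and it returns `v`. -/
theorem nord_c_cur_b (a a' : Fin (n - 1)) (i j : Fin n) {v : Fock n} (hv : v ∈ invariants n) :
    (nord 1 (oddField (.c a')) (cur i)).1 0 (oddMode (.b a) (-1) v) -
      (nord 1 (oddField (.c a')) (cur j)).1 0 (oddMode (.b a) (-1) v) =
      if a' = a then (cur i).1 (-1) v - (cur j).1 (-1) v else 0 := by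
  have hz : ∀ m : ℤ, oddMode (.c a') m (oddMode (.b a) (-1) v) =
      -oddMode (.b a) (-1) (oddMode (.c a') m v) + (if m = 0 ∧ a' = a then (1 : ℂ) else 0) • v :=
    fun m => by
      rw [oddMode_oddMode]
      congr 2
      simp only [oddPairing, ← ite_and]
      congr 2
      simp
  have hb : ∀ m : ℕ, 1 ≤ m → (oddField (.c a')).1 m (oddMode (.b a) (-1) v) = 0 := fun m hm => by
    rw [oddField_apply, hz, hv.1, map_zero, neg_zero, zero_add, if_neg (by omega), zero_smul]
  have h0 : (oddField (.c a')).1 ((0 : ℕ) : ℤ) (oddMode (.b a) (-1) v) =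
      (if a' = a then (1 : ℂ) else 0) • v := by
    have := hv.1 a' 0
    rw [oddField_apply, hz, this]
    simp
  have hcur : ∀ (i : Fin n) (m : ℤ), (cur i).1 m (oddMode (.b a) (-1) v) =
      oddMode (.b a) (-1) ((cur i).1 m v) := fun i m => by
    rw [cur_oddMode]
    simp [oddCharge]
  -- The currents must be subtracted before truncating: their separate zero modes need not vanish on
  -- `v`, only the difference does.
  have hsub : (nord 1 (oddField (.c a')) (cur i)).1 0 (oddMode (.b a) (-1) v) -
      (nord 1 (oddField (.c a')) (cur j)).1 0 (oddMode (.b a) (-1) v) =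
      (nord 1 (oddField (.c a')) (cur i + (-1 : ℂ) • cur j)).1 0 (oddMode (.b a) (-1) v) := by
    rw [nord_add_right, nord_smul_right]
    change _ = _ + (-1 : ℂ) • (nord 1 (oddField (.c a')) (cur j)).1 0 (oddMode (.b a) (-1) v)
    rw [neg_one_smul, sub_eq_add_neg]
  rw [hsub, nord_eq_sum (A := 0) (B := 1) 1 (fun m _ => by
      change (cur i).1 (0 + m) _ + (-1 : ℂ) • (cur j).1 (0 + m) _ = 0
      rw [zero_add, hcur, hcur, hv.2 i j]
      simp) hb]
  rw [Finset.sum_range_zero, Finset.sum_range_one, h0]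
  change 0 + (1 : ℂ) • ((cur i).1 _ _ + (-1 : ℂ) • (cur j).1 _ _) = _
  split_ifs <;> simp [sub_eq_add_neg]

theorem brst_b (a : Fin (n - 1)) {v : Fock n} (hv : v ∈ invariants n) :
    brst n (oddMode (.b a) (-1) v) =
      (cur ⟨a.val, by have := a.isLt; omega⟩).1 (-1) v -
      (cur ⟨a.val + 1, by have := a.isLt; omega⟩).1 (-1) v := by
  rw [brst_apply, Q_eq_sum]
  simp only [nord_c_cur_b _ _ _ _ hv]
  simp

/-- The ghosts reach only neighbouring indices; telescoping from index `0` gives all pairs. -/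
theorem cur_sub_cur_mem_range (i j : Fin n) {v : Fock n} (hv : v ∈ invariants n) :
    (cur i).1 (-1) v - (cur j).1 (-1) v ∈ LinearMap.range (brst n) := by
  have h0 : 0 < n := i.pos
  have key : ∀ (m : ℕ) (hm : m < n),
      (cur ⟨0, h0⟩).1 (-1) v - (cur ⟨m, hm⟩).1 (-1) v ∈ LinearMap.range (brst n) := by
    intro m
    induction m with
    | zero => simp
    | succ m ih =>
      intro hm
      have h1 := ih (by omega)
      have h2 : (cur ⟨m, by omega⟩).1 (-1) v - (cur ⟨m + 1, hm⟩).1 (-1) v ∈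
          LinearMap.range (brst n) := ⟨_, brst_b ⟨m, by omega⟩ hv⟩
      simpa using add_mem h1 h2
  simpa using sub_mem (key j j.isLt) (key i i.isLt)

/-- The exact states obtained from differences of currents acting on invariant states. -/
def currentExact (n : ℕ) : Submodule ℂ (Fock n) :=
  Submodule.span ℂ {w | ∃ i j, ∃ v ∈ invariants n, w = (cur i).1 (-1) v - (cur j).1 (-1) v}

theorem currentExact_le_range : currentExact n ≤ LinearMap.range (brst n) := by
  refine Submodule.span_le.2 ?_
  rintro _ ⟨i, j, v, hv, rfl⟩
  exact cur_sub_cur_mem_range i j hv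

theorem equivalent_of_sub_mem {v w : Fock n} (h : v - w ∈ currentExact n) : Equivalent v w := by
  obtain ⟨u, hu⟩ := currentExact_le_range h
  exact ⟨u, by rw [← brst_apply, hu]⟩

/-- Such an `f` sends spanning states to spanning states, so exactness is preserved without
computing a commutator of `f` with `Q`. -/
theorem map_mem_currentExact (f : Fock n →ₗ[ℂ] Fock n)
    (hinv : ∀ v ∈ invariants n, f v ∈ invariants n)
    (hcomm : ∀ i v, f ((cur i).1 (-1) v) = (cur i).1 (-1) (f v))
    {w : Fock n} (hw : w ∈ currentExact n) : f w ∈ currentExact n := by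
  induction hw using Submodule.span_induction with
  | mem w h =>
    obtain ⟨i, j, v, hv, rfl⟩ := h
    exact Submodule.subset_span ⟨i, j, f v, hinv v hv, by rw [map_sub, hcomm, hcomm]⟩
  | zero => simp
  | add v w _ _ hv hw => simpa using add_mem hv hw
  | smul z v _ hv => simpa using Submodule.smul_mem _ z hv

/-! ### Covariant derivatives -/

/-- The field of `X i Y i`. -/
def bosonCur (i : Fin n) : fields n := nord 1 (evenField (.X i)) (evenField (.Y i))

theorem nop_neg_left (u v : Fock n) : nop (-u) v = -nop u v := by
  rw [nop_eq, nop_eq, ← neg_one_smul ℂ u, map_smul]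
  exact neg_one_smul ℂ ((stateField u).1 (-1) v)

/-- The covariant derivative as a linear map. -/
def covDLin (i : Fin n) : Fock n →ₗ[ℂ] Fock n :=
  evenMode (.X i) (-1) ∘ₗ evenMode (.Y i) (-1) - (2 : ℂ) • (bosonCur i).1 (-1)

theorem covD_eq (i : Fin n) (v : Fock n) : covD i v =
    evenMode (.X i) (-1) (evenMode (.Y i) (-1) v) - (2 : ℂ) • (bosonCur i).1 (-1) v := by
  have h : nop (calA i) v = -(bosonCur i).1 (-1) v := by
    rw [calA, nop_neg_left, nop_eq, stateField_XY, bosonCur]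
  rw [covD, partialD, h, opX, opY, nop_even, nop_even]
  module

theorem covDLin_apply (i : Fin n) (v : Fock n) : covDLin i v = covD i v := (covD_eq i v).symm

theorem evenPairing_boson_of_ne (σ τ : Bool) {i j : Fin n} (h : i ≠ j) :
    evenPairing (boson n σ i) (boson n τ j) = 0 := by
  cases σ <;> cases τ <;> simp [boson, evenPairing, h]

theorem oddPairing_fermion_of_ne (σ τ : Bool) {i j : Fin n} (h : i ≠ j) :
    oddPairing (fermion n σ i) (fermion n τ j) = 0 := by
  cases σ <;> cases τ <;> simp [fermion, oddPairing, h]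

theorem boson_covD (σ : Bool) {i j : Fin n} (h : i ≠ j) (p : ℤ) (v : Fock n) :
    evenMode (boson n σ i) p (covD j v) = covD j (evenMode (boson n σ i) p v) := by
  have hX : evenPairing (boson n σ i) (.X j) = 0 := evenPairing_boson_of_ne σ true h
  have hY : evenPairing (boson n σ i) (.Y j) = 0 := evenPairing_boson_of_ne σ false h
  have e := even_apply_nord_XY (boson n σ i) j p (-1) v
  have eX := fun v => evenMode_evenMode (boson n σ i) (.X j) p (-1) v
  have eY := fun v => evenMode_evenMode (boson n σ i) (.Y j) p (-1) v
  simp only [hX, hY, zero_smul, add_zero, ite_self] at e eX eY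
  rw [covD_eq, covD_eq, map_sub, map_smul, bosonCur, e, eX, eY]

theorem odd_covD (b : OddGen n) (j : Fin n) (p : ℤ) (v : Fock n) :
    oddMode b p (covD j v) = covD j (oddMode b p v) := by
  rw [covD_eq, covD_eq, map_sub, map_smul, bosonCur, odd_apply_nord_XY, evenMode_oddMode,
    evenMode_oddMode]

/-- For `i ≠ j`, `D_i` commutes with all modes of `X_j` and `Y_j`, from which `D_j` is built. -/
theorem covD_comm (i j : Fin n) (v : Fock n) : covD i (covD j v) = covD j (covD i v) := by
  rcases eq_or_ne i j with rfl | h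
  · rfl
  have key : ∀ τ k v, covDLin i ((evenField (boson n τ j)).1 k v) =
      (1 : ℂ) • (evenField (boson n τ j)).1 k (covDLin i v) := fun τ k v => by
    rw [covDLin_apply, covDLin_apply, evenField_apply, boson_covD τ h.symm, one_smul]
  have hX := boson_covD (n := n) true h.symm (-1)
  have hY := boson_covD (n := n) false h.symm (-1)
  have e : covDLin i ((bosonCur j).1 (-1) v) = (bosonCur j).1 (-1) (covDLin i v) := by
    have := map_nord_of_comm (covDLin i) (ε := 1) (by simp) (key true) (key false) (-1) v
    rw [mul_one, one_smul] at this
    exact this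
  change ∀ v, evenMode (.X j) (-1) (covD i v) = covD i (evenMode (.X j) (-1) v) at hX
  change ∀ v, evenMode (.Y j) (-1) (covD i v) = covD i (evenMode (.Y j) (-1) v) at hY
  rw [covD_eq j, covD_eq j, hY, hX, ← covDLin_apply i, map_sub, map_smul, e, covDLin_apply,
    covDLin_apply]

instance covD_leftCommutative : LeftCommutative (covD (n := n)) := ⟨covD_comm⟩

/-- As the `D_k` commute, the fold depends on the list only up to permutation, and any `j ∈ J` may
be applied last. -/
theorem covDProd_eq_covD {J : Finset (Fin n)} {j : Fin n} (hj : j ∈ J) (v : Fock n) :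
    covDProd J v = covD j (covDProd (J \ {j}) v) := by
  have hp : (J.sort (· ≤ ·)).Perm (j :: (J \ {j}).sort (· ≤ ·)) := by
    rw [List.perm_ext_iff_of_nodup (Finset.sort_nodup _ _)
      (by simp [Finset.sort_nodup])]
    intro a
    by_cases h : a = j <;> simp [h, hj]
  exact hp.foldr_eq v

theorem covDProd_comm (O : Fock n →ₗ[ℂ] Fock n) {J : Finset (Fin n)}
    (h : ∀ k ∈ J, ∀ v, O (covD k v) = covD k (O v)) (v : Fock n) :
    O (covDProd J v) = covDProd J (O v) := by
  have key : ∀ l : List (Fin n), (∀ k ∈ l, k ∈ J) → O (l.foldr covD v) = l.foldr covD (O v) := by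
    intro l
    induction l with
    | nil => simp
    | cons a l ih =>
      intro hl
      rw [List.foldr_cons, List.foldr_cons, h a (hl a (by simp)),
        ih fun k hk => hl k (by simp [hk])]
  exact key _ (by simp)

theorem covDProd_smul (J : Finset (Fin n)) (z : ℂ) (v : Fock n) :
    covDProd J (z • v) = z • covDProd J v :=
  (covDProd_comm (z • LinearMap.id) (fun k _ v => by
    simp only [LinearMap.smul_apply, LinearMap.id_apply, ← covDLin_apply, map_smul]) v).symm

theorem covDProd_zero (J : Finset (Fin n)) : covDProd J (0 : Fock n) = 0 := by
  simpa using covDProd_smul J 0 (0 : Fock n)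

/-! ### Products of creation modes -/

/-- The `i`-th factor of `hatX I` or `hatY I`. -/
def factor (σ : Bool) (I : Finset (Fin n)) (i : Fin n) : Fock n →ₗ[ℂ] Fock n :=
  if i ∈ I then oddMode (fermion n σ i) (-1) else evenMode (boson n σ i) (-1)

/-- The common form of `hatX I` and `hatY I`. -/
def hat (σ : Bool) (I : Finset (Fin n)) : Fock n :=
  (List.finRange n).foldr (fun i v => factor σ I i v) vac

theorem hat_eq_nestedProd (σ : Bool) (I : Finset (Fin n)) : hat σ I =
    nestedProd fun i => if i ∈ I then oddMode (fermion n σ i) (-1) vac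
      else evenMode (boson n σ i) (-1) vac := by
  unfold hat nestedProd
  congr 1
  funext i v
  by_cases h : i ∈ I <;> simp [factor, h, nop_even, nop_odd]

theorem hatX_eq_hat (I : Finset (Fin n)) : hatX I = hat true I := (hat_eq_nestedProd true I).symm

theorem hatY_eq_hat (I : Finset (Fin n)) : hatY I = hat false I := (hat_eq_nestedProd false I).symm

/-- The product `hat` without its `j`-th factor. -/
def hatErase (σ : Bool) (I : Finset (Fin n)) (j : Fin n) (l : List (Fin n)) : Fock n :=
  l.foldr (fun i v => if i = j then v else factor σ I i v) vac

theorem boson_factor (σ τ : Bool) (I : Finset (Fin n)) {i j : Fin n} (h : i ≠ j) (p : ℤ)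
    (v : Fock n) : evenMode (boson n τ i) p (factor σ I j v) =
      factor σ I j (evenMode (boson n τ i) p v) := by
  unfold factor
  split_ifs
  · rw [evenMode_oddMode]
  · rw [evenMode_evenMode, evenPairing_boson_of_ne τ σ h]
    simp

theorem odd_factor (σ : Bool) (I : Finset (Fin n)) {b : OddGen n} {j : Fin n}
    (h : oddPairing b (fermion n σ j) = 0) (p : ℤ) (v : Fock n) :
    oddMode b p (factor σ I j v) = (if j ∈ I then (-1 : ℂ) else 1) •
      factor σ I j (oddMode b p v) := by
  unfold factor
  split_ifs
  · rw [oddMode_oddMode, h]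
    simp
  · rw [evenMode_oddMode, one_smul]

theorem foldr_factor_of_notMem (σ : Bool) {I I' : Finset (Fin n)} {j : Fin n}
    (hI : ∀ i ≠ j, i ∈ I' ↔ i ∈ I) {l : List (Fin n)} (hj : j ∉ l) :
    l.foldr (fun i v => factor σ I' i v) vac = hatErase σ I j l := by
  induction l with
  | nil => rfl
  | cons a l ih =>
    have ha : a ≠ j := fun h => hj (by simp [h])
    have := ih fun h => hj (by simp [h])
    rw [List.foldr_cons, this]
    simp [hatErase, ha, factor, hI a ha]

theorem foldr_factor_boson (σ : Bool) {I : Finset (Fin n)} {j : Fin n} (hI : j ∉ I)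
    {l : List (Fin n)} (hl : l.Nodup) (hj : j ∈ l) :
    l.foldr (fun i v => factor σ I i v) vac =
      evenMode (boson n σ j) (-1) (hatErase σ I j l) := by
  induction l with
  | nil => simp at hj
  | cons a l ih =>
    rw [List.nodup_cons] at hl
    rcases eq_or_ne a j with rfl | ha
    · rw [List.foldr_cons, foldr_factor_of_notMem σ (fun _ _ => Iff.rfl) hl.1]
      simp [hatErase, factor, hI]
    · rw [List.foldr_cons, ih hl.2 (by simpa [ha.symm] using hj), ← boson_factor _ _ _ ha.symm]
      simp [hatErase, ha]

/-- Bringing the fermion of index `j` to the front costs a sign for each fermion before it; as the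
list increases, these are the `k ∈ I` with `k < j`. -/
theorem foldr_factor_fermion (σ : Bool) {I : Finset (Fin n)} {j : Fin n}
    {l : List (Fin n)} (hl : l.Pairwise (· < ·)) (hj : j ∈ l) :
    l.foldr (fun i v => factor σ (I ∪ {j}) i v) vac =
      (-1 : ℂ) ^ (l.filter fun k => k ∈ I ∧ k < j).length •
        oddMode (fermion n σ j) (-1) (hatErase σ I j l) := by
  induction l with
  | nil => simp at hj
  | cons a l ih =>
    rw [List.pairwise_cons] at hl
    rcases eq_or_ne a j with rfl | ha
    · have h1 : (a :: l).filter (fun k => decide (k ∈ I ∧ k < a)) = [] := by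
        rw [List.filter_eq_nil_iff]
        intro k hk
        rcases List.mem_cons.1 hk with rfl | hk
        · simp
        · simp [(hl.1 k hk).not_gt]
      rw [h1, List.foldr_cons, foldr_factor_of_notMem (j := a) (I := I) σ (fun i hi => by simp [hi])
        (fun h => (hl.1 a h).false)]
      simp [hatErase, factor]
    · have hj' : j ∈ l := by simpa [ha.symm] using hj
      have haj : a < j := hl.1 j hj'
      have e : hatErase σ I j (a :: l) = factor σ I a (hatErase σ I j l) := by simp [hatErase, ha]
      have e' : factor σ (I ∪ {j}) a = factor σ I a := by simp [factor, ha]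
      rw [List.foldr_cons, ih hl.2 hj', e, odd_factor σ I (oddPairing_fermion_of_ne σ σ ha.symm),
        map_smul, e', List.filter_cons]
      by_cases h : a ∈ I <;> simp [h, haj, pow_succ]

theorem length_filter_eq_fermionCount (I : Finset (Fin n)) (j : Fin n) :
    ((List.finRange n).filter fun k => k ∈ I ∧ k < j).length = fermionCount I j := by
  rw [fermionCount, ← List.toFinset_card_of_nodup ((List.nodup_finRange n).filter _)]
  congr 1
  ext k
  simp

/-- The vector `v` is annihilated by the nonnegative modes of the matter fields of index `j`. -/
def AnnihilatedAt (j : Fin n) (v : Fock n) : Prop :=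
  ∀ (τ : Bool) (m : ℕ), evenMode (boson n τ j) m v = 0 ∧ oddMode (fermion n τ j) m v = 0

theorem annihilatedAt_hatErase (σ : Bool) (I : Finset (Fin n)) (j : Fin n) (l : List (Fin n)) :
    AnnihilatedAt j (hatErase σ I j l) := by
  intro τ m
  induction l with
  | nil => exact ⟨evenMode_vac _ m, oddMode_vac _ m⟩
  | cons a l ih =>
    rcases eq_or_ne a j with rfl | ha
    · simpa [hatErase] using ih
    · have e : hatErase σ I j (a :: l) = factor σ I a (hatErase σ I j l) := by simp [hatErase, ha]
      rw [e, boson_factor _ _ _ ha.symm, odd_factor σ I (oddPairing_fermion_of_ne τ σ ha.symm),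
        ih.1, ih.2]
      simp

/-- The common form of `hatX₂` and `hatY₂`. -/
def hat₂ (σ : Bool) (I J : Finset (Fin n)) : Fock n := covDProd J (hat σ I)

/-- Reduction to one site: the two products differ only in the factor of index `j`, and the `D_k`
with `k ≠ j` commute with the modes of that index. The common remainder `w` looks like a vacuum at
site `j`. -/
theorem exists_hat₂_eq (σ : Bool) {I J : Finset (Fin n)} {j : Fin n} (hI : j ∉ I) (hJ : j ∉ J) :
    ∃ w, AnnihilatedAt j w ∧ hat₂ σ I J = evenMode (boson n σ j) (-1) w ∧
      hat₂ σ (I ∪ {j}) J = (-1 : ℂ) ^ fermionCount I j • oddMode (fermion n σ j) (-1) w := by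
  have hne : ∀ k ∈ J, j ≠ k := fun k hk h => hJ (h ▸ hk)
  have hb : ∀ τ p v, evenMode (boson n τ j) p (covDProd J v) =
      covDProd J (evenMode (boson n τ j) p v) := fun τ p v =>
    covDProd_comm _ (fun k hk v => boson_covD τ (hne k hk) p v) v
  have hf : ∀ τ p v, oddMode (fermion n τ j) p (covDProd J v) =
      covDProd J (oddMode (fermion n τ j) p v) := fun τ p v =>
    covDProd_comm _ (fun k hk v => odd_covD _ _ p v) v
  refine ⟨covDProd J (hatErase σ I j (List.finRange n)), fun τ m => ?_, ?_, ?_⟩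
  · have := annihilatedAt_hatErase σ I j (List.finRange n) τ m
    rw [hb, hf, this.1, this.2, covDProd_zero]
    simp
  · rw [hat₂, hat, foldr_factor_boson σ hI (List.nodup_finRange n) (List.mem_finRange j), hb]
  · rw [hat₂, hat, foldr_factor_fermion σ (List.pairwise_lt_finRange n) (List.mem_finRange j),
      length_filter_eq_fermionCount, covDProd_smul, hf]

theorem c_hat₂ (σ : Bool) (I J : Finset (Fin n)) (a : Fin (n - 1)) (m : ℕ) :
    oddMode (.c a) m (hat₂ σ I J) = 0 := by
  have h : ∀ l : List (Fin n),
      oddMode (.c a) m (l.foldr (fun i v => factor σ I i v) vac) = 0 := by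
    intro l
    induction l with
    | nil => exact oddMode_vac _ m
    | cons k l ih =>
      rw [List.foldr_cons, odd_factor σ I (by cases σ <;> rfl), ih, map_zero, smul_zero]
  rw [hat₂, covDProd_comm _ (fun k _ v => odd_covD _ _ _ v), hat, h, covDProd_zero]

/-! ### Local computations -/

theorem evenCharge_self (σ : Bool) (j : Fin n) : evenCharge j (boson n σ j) = sideCharge σ := by
  rw [evenCharge_boson, if_pos rfl]

theorem oddCharge_self (σ : Bool) (j : Fin n) : oddCharge j (fermion n σ j) = sideCharge σ := by
  rw [oddCharge_fermion, if_pos rfl]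

theorem bosonCur_boson (σ : Bool) (j : Fin n) (k p : ℤ) (v : Fock n) :
    (bosonCur j).1 k (evenMode (boson n σ j) p v) =
      evenMode (boson n σ j) p ((bosonCur j).1 k v) +
        sideCharge σ • evenMode (boson n σ j) (p + k) v := by
  rw [bosonCur, even_apply_nord_XY, add_comm k p]
  cases σ <;> simp [boson, evenPairing, sideCharge]

theorem AnnihilatedAt.cur_eq_zero {j : Fin n} {w : Fock n} (hw : AnnihilatedAt j w) (m : ℕ) :
    (cur j).1 m w = 0 := by
  rw [cur_apply, nord_eq_zero_of_annihilated 1 (fun m => (hw true m).1) (fun m => (hw false m).1),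
    nord_eq_zero_of_annihilated (-1) (fun m => (hw false m).2) (fun m => (hw true m).2), add_zero]

theorem AnnihilatedAt.bosonCur_eq {j : Fin n} {w : Fock n} (hw : AnnihilatedAt j w) :
    (bosonCur j).1 (-1) w = evenMode (.X j) (-1) (evenMode (.Y j) (-1) w) :=
  nord_neg_one_of_annihilated 1 (fun m => (hw true m).1) (fun m => (hw false m).1)

theorem AnnihilatedAt.cur_eq {j : Fin n} {w : Fock n} (hw : AnnihilatedAt j w) :
    (cur j).1 (-1) w = evenMode (.X j) (-1) (evenMode (.Y j) (-1) w) +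
      oddMode (.psi j) (-1) (oddMode (.chi j) (-1) w) := by
  rw [cur_apply, nord_neg_one_of_annihilated 1 (fun m => (hw true m).1) (fun m => (hw false m).1),
    nord_neg_one_of_annihilated (-1) (fun m => (hw false m).2) (fun m => (hw true m).2)]
  rfl

theorem evenCre_comm (a b : EvenGen n) (v : Fock n) :
    evenMode a (-1) (evenMode b (-1) v) = evenMode b (-1) (evenMode a (-1) v) := by
  rw [evenMode_evenMode]
  simp

theorem AnnihilatedAt.covD_boson (σ : Bool) {j : Fin n} {w : Fock n} (hw : AnnihilatedAt j w) :
    covD j (evenMode (boson n σ j) (-1) w) =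
      -evenMode (boson n σ j) (-1) (evenMode (.X j) (-1) (evenMode (.Y j) (-1) w)) -
        (2 * sideCharge σ) • evenMode (boson n σ j) (-2) w := by
  rw [covD_eq, bosonCur_boson, hw.bosonCur_eq, evenCre_comm (.Y j), evenCre_comm (.X j),
    show (-1 + -1 : ℤ) = -2 by norm_num]
  module

/-- The fermion in `M_j^±` contracts with its partner in the state, which leaves the boson with one
derivative; this contraction is the `j = 1` term of the creation sum. -/
theorem AnnihilatedAt.matter_fermion (σ : Bool) {j : Fin n} {w : Fock n}
    (hw : AnnihilatedAt j w) : (matter σ j).1 (-1) (oddMode (fermion n σ j) (-1) w) =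
      evenMode (boson n σ j) (-2) w + evenMode (boson n σ j) (-1)
        (oddMode (fermion n (!σ) j) (-1) (oddMode (fermion n σ j) (-1) w)) := by
  have hp : oddPairing (fermion n (!σ) j) (fermion n σ j) = 1 := by
    cases σ <;> simp [fermion, oddPairing]
  have ho : ∀ m : ℤ, oddMode (fermion n (!σ) j) m (oddMode (fermion n σ j) (-1) w) =
      -oddMode (fermion n σ j) (-1) (oddMode (fermion n (!σ) j) m w) +
        (if m = 0 then (1 : ℂ) else 0) • w := fun m => by
    rw [oddMode_oddMode, hp]
    congr 3
    simp
  rw [matter, nord_eq_sum (A := 2) (B := 0) 1 (fun m hm => by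
      have h1 : (-1 + (m : ℤ)) = ((m - 1 : ℕ) : ℤ) := by omega
      rw [oddField_apply, ho, h1, (hw (!σ) _).2, if_neg (by omega)]
      simp) (fun m _ => by
      rw [evenField_apply, evenMode_oddMode, (hw σ m).1, map_zero])]
  have h0 : oddMode (fermion n (!σ) j) 0 (oddMode (fermion n σ j) (-1) w) = w := by
    have h1 := (hw (!σ) 0).2
    rw [Nat.cast_zero] at h1
    rw [ho, h1]
    simp
  rw [Finset.sum_range_succ, Finset.sum_range_one, Finset.sum_range_zero, smul_zero, add_zero,
    evenField_apply, evenField_apply, oddField_apply, oddField_apply]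
  norm_num
  rw [h0, add_comm]

/-- The covariant derivative in terms of the current and of `M_j^±`. -/
theorem AnnihilatedAt.covD_boson_eq (σ : Bool) {j : Fin n} {w : Fock n}
    (hw : AnnihilatedAt j w) : covD j (evenMode (boson n σ j) (-1) w) =
      -(cur j).1 (-1) (evenMode (boson n σ j) (-1) w) -
        sideCharge σ • (matter σ j).1 (-1) (oddMode (fermion n σ j) (-1) w) := by
  have h : sideCharge σ • oddMode (fermion n (!σ) j) (-1) (oddMode (fermion n σ j) (-1) w) =
      -oddMode (.psi j) (-1) (oddMode (.chi j) (-1) w) := by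
    cases σ
    · change (1 : ℂ) • oddMode (.chi j) (-1) (oddMode (.psi j) (-1) w) = _
      rw [oddMode_oddMode]
      simp
    · exact neg_one_smul _ _
  have h' := congrArg (evenMode (boson n σ j) (-1)) h
  rw [map_smul, map_neg] at h'
  -- The derivative term of `covD_boson`, with coefficient `-2 * sideCharge σ`, is supplied half by
  -- the current and half by the contraction in `M_j^±`; the cubic terms with fermions cancel by
  -- `h'`.
  rw [hw.covD_boson, hw.matter_fermion, cur_evenMode, hw.cur_eq, evenCharge_self,
    show (-1 + -1 : ℤ) = -2 by norm_num, smul_add, h', map_add]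
  module

theorem AnnihilatedAt.cur_boson (σ : Bool) {j : Fin n} {w : Fock n} (hw : AnnihilatedAt j w)
    (m : ℕ) : (cur j).1 m (evenMode (boson n σ j) (-1) w) =
      if m = 0 then sideCharge σ • evenMode (boson n σ j) (-1) w else 0 := by
  rw [cur_evenMode, hw.cur_eq_zero, map_zero, zero_add, evenCharge_self]
  rcases m with _ | m
  · simp
  · rw [if_neg (by omega), show (-1 + ((m + 1 : ℕ) : ℤ)) = m by push_cast; ring, (hw σ m).1,
      smul_zero]

theorem AnnihilatedAt.cur_fermion (σ : Bool) {j : Fin n} {w : Fock n} (hw : AnnihilatedAt j w)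
    (m : ℕ) : (cur j).1 m (oddMode (fermion n σ j) (-1) w) =
      if m = 0 then sideCharge σ • oddMode (fermion n σ j) (-1) w else 0 := by
  rw [cur_oddMode, hw.cur_eq_zero, map_zero, zero_add, oddCharge_self]
  rcases m with _ | m
  · simp
  · rw [if_neg (by omega), show (-1 + ((m + 1 : ℕ) : ℤ)) = m by push_cast; ring, (hw σ m).2,
      smul_zero]

/-- The delicate case is `m = 1`: the contractions with the cubic term and with the derivative term
cancel, because `𝒜_j` enters `D_j` with total coefficient `2`. -/
theorem AnnihilatedAt.cur_covD_boson (σ : Bool) {j : Fin n} {w : Fock n}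
    (hw : AnnihilatedAt j w) (m : ℕ) :
    (cur j).1 m (covD j (evenMode (boson n σ j) (-1) w)) =
      if m = 0 then sideCharge σ • covD j (evenMode (boson n σ j) (-1) w) else 0 := by
  have hX : ∀ k : ℕ, evenMode (.X j) k w = 0 := fun k => (hw true k).1
  have hY : ∀ k : ℕ, evenMode (.Y j) k w = 0 := fun k => (hw false k).1
  have hE := hw σ
  have qX : evenCharge j (.X j) = -1 := evenCharge_self true j
  have qY : evenCharge j (.Y j) = 1 := evenCharge_self false j
  have hq : sideCharge σ * sideCharge σ = 1 := by cases σ <;> simp [sideCharge]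
  rw [hw.covD_boson, map_sub, map_neg, map_smul, cur_evenMode, cur_evenMode, cur_evenMode,
    cur_evenMode, hw.cur_eq_zero, evenCharge_self, qX, qY]
  rcases m with _ | _ | m
  · simp only [map_zero, zero_add, map_add, map_smul, if_true, Nat.cast_zero, add_zero]
    module
  · have x0 : evenMode (.X j) 0 (evenMode (.Y j) (-1) w) = w := by
      have := hX 0
      rw [Nat.cast_zero] at this
      rw [evenMode_evenMode, this]
      simp [evenPairing]
    have y0 : evenMode (.Y j) 0 w = 0 := hY 0
    have e : evenMode (boson n σ j) 0 (evenMode (.X j) (-1) (evenMode (.Y j) (-1) w)) =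
        -sideCharge σ • evenMode (boson n σ j) (-1) w := by
      cases σ
      · change evenMode (.Y j) 0 _ = -(1 : ℂ) • evenMode (.Y j) (-1) w
        rw [evenMode_evenMode, evenMode_evenMode (.Y j) (.Y j), y0]
        simp [evenPairing]
      · change evenMode (.X j) 0 _ = -(-1 : ℂ) • evenMode (.X j) (-1) w
        rw [evenMode_evenMode, x0]
        simp [evenPairing]
    rw [if_neg (by omega), show (-1 + ((0 + 1 : ℕ) : ℤ)) = 0 by norm_num,
      show (-2 + ((0 + 1 : ℕ) : ℤ)) = -1 by norm_num, x0, y0, e]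
    simp only [map_zero, zero_add, map_smul, smul_zero, add_zero, smul_smul, mul_neg,
      mul_assoc, hq]
    module
  · have e1 : (-1 + ((m + 1 + 1 : ℕ) : ℤ)) = ((m + 1 : ℕ) : ℤ) := by push_cast; ring
    have e2 : (-2 + ((m + 1 + 1 : ℕ) : ℤ)) = (m : ℤ) := by push_cast; ring
    have x0 : evenMode (.X j) ((m + 1 : ℕ) : ℤ) (evenMode (.Y j) (-1) w) = 0 := by
      rw [evenMode_evenMode, hX, if_neg (by omega)]
      simp
    have z : evenMode (boson n σ j) ((m + 1 : ℕ) : ℤ)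
        (evenMode (.X j) (-1) (evenMode (.Y j) (-1) w)) = 0 := by
      rw [evenMode_evenMode, evenMode_evenMode _ (.Y j), (hE _).1, if_neg (by omega)]
      simp
    rw [if_neg (by omega), e1, e2, x0, hY, z, (hE m).1]
    simp

theorem hat₂_eq_covD (σ : Bool) (I : Finset (Fin n)) {J : Finset (Fin n)} {j : Fin n}
    (hj : j ∈ J) : hat₂ σ I J = covD j (hat₂ σ I (J \ {j})) := covDProd_eq_covD hj _

/-- At site `i` there is a differentiated boson, a fermion or a boson, and all three carry the same
charge and no higher poles. Disjointness excludes a `D_i` acting on a fermionic site. -/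
theorem cur_hat₂ (σ : Bool) {I J : Finset (Fin n)} (h : Disjoint I J) (i : Fin n) (m : ℕ) :
    (cur i).1 m (hat₂ σ I J) = if m = 0 then sideCharge σ • hat₂ σ I J else 0 := by
  by_cases hJ : i ∈ J
  · have hI : i ∉ I := fun hI => Finset.disjoint_left.1 h hI hJ
    obtain ⟨w, hw, e, -⟩ := exists_hat₂_eq σ (J := J \ {i}) hI (by simp)
    rw [hat₂_eq_covD σ I hJ, e, hw.cur_covD_boson]
  by_cases hI : i ∈ I
  · obtain ⟨w, hw, -, e⟩ := exists_hat₂_eq σ (I := I \ {i}) (j := i) (by simp) hJ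
    rw [Finset.sdiff_union_of_subset (by simpa using hI)] at e
    rw [e, map_smul, hw.cur_fermion]
    split_ifs
    · rw [smul_comm]
    · rw [smul_zero]
  · obtain ⟨w, hw, e, -⟩ := exists_hat₂_eq σ hI hJ
    rw [e, hw.cur_boson]

theorem hat₂_mem_invariants (σ : Bool) {I J : Finset (Fin n)} (h : Disjoint I J) :
    hat₂ σ I J ∈ invariants n :=
  ⟨c_hat₂ σ I J, fun i j m => by rw [cur_hat₂ σ h, cur_hat₂ σ h]⟩

/-! ### The recursion -/

theorem nop_opU_add_opUF (v : Fock n) : nop (opU n + opUF n) v =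
    -((1 / n : ℂ) • ∑ i : Fin n, (cur i).1 (-1) v) := by
  have h : opU n + opUF n = (-(1 / n : ℂ)) • ∑ i : Fin n, current i := by
    simp only [opU, opUF, current, Finset.sum_add_distrib, smul_add, neg_smul]
  rw [h, nop_eq, map_smul, map_sum]
  simp only [stateField_current]
  rw [← neg_smul]
  rw [Submodule.coe_smul, Pi.smul_apply, LinearMap.smul_apply, Submodule.coe_sum, Finset.sum_apply, LinearMap.sum_apply]

/-- `U + U_F` is minus the average of the currents, so the difference is an average of the exact
states `(J_i - J_j) v`. -/
theorem nop_opU_add_cur_mem (j : Fin n) {v : Fock n} (hv : v ∈ invariants n) :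
    -(cur j).1 (-1) v - nop (opU n + opUF n) v ∈ currentExact n := by
  have hn : (n : ℂ) ≠ 0 := Nat.cast_ne_zero.2 j.pos.ne'
  have e : -(cur j).1 (-1) v - nop (opU n + opUF n) v =
      (1 / n : ℂ) • ∑ i : Fin n, ((cur i).1 (-1) v - (cur j).1 (-1) v) := by
    rw [nop_opU_add_opUF, Finset.sum_sub_distrib, Finset.sum_const, Finset.card_univ,
      Fintype.card_fin, ← Nat.cast_smul_eq_nsmul ℂ, smul_sub, smul_smul, one_div,
      inv_mul_cancel₀ hn]
    module
  rw [e]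
  exact Submodule.smul_mem _ _ (Submodule.sum_mem _ fun i _ =>
    Submodule.subset_span ⟨i, j, v, hv, rfl⟩)

theorem nop_opU_mem {v : Fock n} (hv : v ∈ currentExact n) :
    nop (opU n + opUF n) v ∈ currentExact n := by
  rw [nop_opU_add_opUF]
  exact Submodule.neg_mem _ (Submodule.smul_mem _ _ (Submodule.sum_mem _ fun i _ =>
    map_mem_currentExact ((cur i).1 (-1)) (fun _ hv => cur_mem_invariants i _ hv)
      (fun j _ => cur_cur i j _ _ _) hv))

theorem matter_mem (σ : Bool) (j : Fin n) {v : Fock n} (hv : v ∈ currentExact n) :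
    (matter σ j).1 (-1) v ∈ currentExact n :=
  map_mem_currentExact ((matter σ j).1 (-1)) (fun _ hv => matter_mem_invariants σ j _ hv)
    (fun i v => (cur_matter σ i j _ _ v).symm) hv

/-- This is `covD_boson_eq` at site `j` with the current replaced by `U + U_F`. It is stated modulo
`currentExact`, which is finer than equivalence, so that it can be iterated. -/
theorem covD_hat₂_sub_mem (σ : Bool) {I J : Finset (Fin n)} {j : Fin n} (hIJ : Disjoint I J)
    (hI : j ∉ I) (hJ : j ∉ J) :
    covD j (hat₂ σ I J) - (nop (opU n + opUF n) (hat₂ σ I J) -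
      (sideCharge σ * (-1) ^ fermionCount I j) •
        (matter σ j).1 (-1) (hat₂ σ (I ∪ {j}) J)) ∈ currentExact n := by
  have hinv := hat₂_mem_invariants σ hIJ
  obtain ⟨w, hw, e1, e2⟩ := exists_hat₂_eq σ hI hJ
  have h := nop_opU_add_cur_mem j hinv
  have hs : ((-1 : ℂ) ^ fermionCount I j) * (-1) ^ fermionCount I j = 1 := by
    rw [← mul_pow]
    simp
  rw [e2, map_smul, smul_smul, mul_assoc, hs, mul_one]
  rw [e1] at h ⊢
  rw [hw.covD_boson_eq]
  convert h using 1
  abel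

/-- `M_i^+` and `M_i^-`. -/
def opM (σ : Bool) (i : Fin n) : Fock n := cond σ (opMplus i) (opMminus i)

theorem nop_opM (σ : Bool) (i : Fin n) (v : Fock n) :
    nop (opM σ i) v = (matter σ i).1 (-1) v := by
  cases σ
  · rw [opM, cond_false, nop_eq, stateField_opMminus]
  · rw [opM, cond_true, nop_eq, stateField_opMplus]

theorem opM_mem_generators (σ : Bool) (i : Fin n) : opM σ i ∈ generators n := by
  cases σ
  · exact .inl (.inl (.inr ⟨i, rfl⟩))
  · exact .inl (.inl (.inl (.inr ⟨i, rfl⟩)))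

theorem hat_mem_generators (σ : Bool) (I : Finset (Fin n)) : hat σ I ∈ generators n := by
  cases σ
  · exact .inr ⟨I, hatY_eq_hat I⟩
  · exact .inl (.inr ⟨I, hatX_eq_hat I⟩)

/-- Induction on `J` for all `I` at once, because the recursion moves `j` from `J` into `I`. When
`J` is empty a generator remains. -/
theorem exists_polynomial_hat₂ (σ : Bool) (J : Finset (Fin n)) :
    ∀ I : Finset (Fin n), Disjoint I J → ∃ P : Fock n,
      IsNormallyOrderedPolynomial (generators n) P ∧ hat₂ σ I J - P ∈ currentExact n := by
  induction J using Finset.induction_on with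
  | empty =>
    intro I _
    refine ⟨hat σ I, .mem _ (hat_mem_generators σ I), ?_⟩
    have : hat₂ σ I ∅ = hat σ I := by simp [hat₂, covDProd]
    rw [this, sub_self]
    exact zero_mem _
  | insert j J hj ih =>
    intro I hIJ
    rw [Finset.disjoint_insert_right] at hIJ
    obtain ⟨P, hP, eP⟩ := ih I hIJ.2
    obtain ⟨R, hR, eR⟩ := ih (I ∪ {j}) (by
      rw [Finset.disjoint_union_left]
      exact ⟨hIJ.2, by simpa using hj⟩)
    have hU : IsNormallyOrderedPolynomial (generators n) (opU n + opUF n) :=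
      .add _ _ (.mem _ (by simp [generators])) (.mem _ (by simp [generators]))
    refine ⟨nop (opU n + opUF n) P + (-(sideCharge σ * (-1) ^ fermionCount I j)) •
      nop (opM σ j) R, .add _ _ (.nop _ _ hU hP)
        (.smul _ _ (.nop _ _ (.mem _ (opM_mem_generators σ j)) hR)), ?_⟩
    have h := covD_hat₂_sub_mem σ hIJ.2 hIJ.1 hj
    have h1 := nop_opU_mem eP
    have h2 := Submodule.smul_mem _ (sideCharge σ * (-1) ^ fermionCount I j) (matter_mem σ j eR)
    rw [hat₂_eq_covD σ I (Finset.mem_insert_self j J), Finset.insert_sdiff_of_mem _ (by simp),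
      Finset.sdiff_singleton_eq_erase, Finset.erase_eq_of_notMem hj, nop_opM]
    rw [nop_sub] at h1
    rw [map_sub, smul_sub] at h2
    -- The error is that of the recursion itself plus the errors of `P` and `R` multiplied by `U +
    -- U_F` and `M_j^±`.
    convert sub_mem (add_mem h h1) h2 using 1
    module

end BoundaryVOA

end

/-! ### The main theorem -/

open BoundaryVOA in
theorem mainTheorem9 (n : ℕ) (hn : 2 ≤ n) :
    (∀ (I J : Finset (Fin n)) (j : Fin n), Disjoint I J → j ∈ J →
      (BoundaryVOA.hatX₂ I J = BoundaryVOA.covD j (BoundaryVOA.hatX₂ I (J \ {j})) ∧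
        BoundaryVOA.Equivalent
          (BoundaryVOA.covD j (BoundaryVOA.hatX₂ I (J \ {j})))
          (BoundaryVOA.nop (BoundaryVOA.opU n + BoundaryVOA.opUF n)
              (BoundaryVOA.hatX₂ I (J \ {j})) +
            ((-1 : ℂ) ^ BoundaryVOA.fermionCount I j) •
              BoundaryVOA.nop (BoundaryVOA.opMplus j)
                (BoundaryVOA.hatX₂ (I ∪ {j}) (J \ {j})))) ∧
      (BoundaryVOA.hatY₂ I J = BoundaryVOA.covD j (BoundaryVOA.hatY₂ I (J \ {j})) ∧
        BoundaryVOA.Equivalent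
          (BoundaryVOA.covD j (BoundaryVOA.hatY₂ I (J \ {j})))
          (BoundaryVOA.nop (BoundaryVOA.opU n + BoundaryVOA.opUF n)
              (BoundaryVOA.hatY₂ I (J \ {j})) -
            ((-1 : ℂ) ^ BoundaryVOA.fermionCount I j) •
              BoundaryVOA.nop (BoundaryVOA.opMminus j)
                (BoundaryVOA.hatY₂ (I ∪ {j}) (J \ {j}))))) ∧
    (∀ I : Finset (Fin n),
      (∃ P : BoundaryVOA.Fock n,
        BoundaryVOA.IsNormallyOrderedPolynomial (BoundaryVOA.generators n) P ∧
          BoundaryVOA.Equivalent (BoundaryVOA.calX I) P) ∧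
      (∃ P : BoundaryVOA.Fock n,
        BoundaryVOA.IsNormallyOrderedPolynomial (BoundaryVOA.generators n) P ∧
          BoundaryVOA.Equivalent (BoundaryVOA.calY I) P)) := by
  have eX : ∀ I J : Finset (Fin n), hatX₂ I J = hat₂ true I J := fun I J => by
    rw [hatX₂, hatX_eq_hat, hat₂]
  have eY : ∀ I J : Finset (Fin n), hatY₂ I J = hat₂ false I J := fun I J => by
    rw [hatY₂, hatY_eq_hat, hat₂]
  refine ⟨fun I J j hIJ hj => ?_, fun I => ?_⟩
  · have hI : j ∉ I := fun hI => Finset.disjoint_left.1 hIJ hI hj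
    have hd : Disjoint I (J \ {j}) := hIJ.mono_right Finset.sdiff_subset
    refine ⟨⟨covDProd_eq_covD hj _, equivalent_of_sub_mem ?_⟩,
      ⟨covDProd_eq_covD hj _, equivalent_of_sub_mem ?_⟩⟩
    · have h := covD_hat₂_sub_mem true hd hI (by simp)
      rw [← nop_opM] at h
      simpa [eX, sideCharge, opM] using h
    · have h := covD_hat₂_sub_mem false hd hI (by simp)
      rw [← nop_opM] at h
      simpa [eY, sideCharge, opM] using h
  -- The bosonic operators are the case without fermions, with all derivatives still to be removed.
  · have cX : calX I = hat₂ true ∅ I := by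
      rw [← eX, calX, hatX₂, hatX]
      simp
    have cY : calY I = hat₂ false ∅ I := by
      rw [← eY, calY, hatY₂, hatY]
      simp
    obtain ⟨P, hP, h⟩ := exists_polynomial_hat₂ true I ∅ (Finset.disjoint_empty_left _)
    obtain ⟨R, hR, h'⟩ := exists_polynomial_hat₂ false I ∅ (Finset.disjoint_empty_left _)
    exact ⟨⟨P, hP, cX ▸ equivalent_of_sub_mem h⟩, ⟨R, hR, cY ▸ equivalent_of_sub_mem h'⟩⟩
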